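/- **Setting.** A taxonomy $\Psi$ is a partial order $\le$ on a finite set $\mathcal I$ of items; its size $|\Psi|$ is the number of items plus the number of pairs of its covering relation. For sets of items $A,B$ write $A\preceq B$ if every $i\in A$ satisfies $i\le j$ for some $j\in B$; the itemset taxonomy is the set of antichains of $\Psi$, partially ordered by $\preceq$. A database $D$ is a finite multiset of subsets of $\mathcal I$ (transactions). The support of $A\subseteq\mathcal I$ in $D$ is $|\{T\in D: A\preceq T\}|/|D|$ (and $0$ if $D$ is empty), and $A$ is frequent if its support exceeds $\Theta$, where $0<\Theta<1$ is a predefined threshold. $MFI$ and $MII$ denote the sets of maximal frequent and of minimal infrequent elements of the itemset taxonomy. MineFreq (with threshold $\Theta$) is the following problem: given a taxonomy $\Psi$ as input, and given access to an unknown database $D$ only through crowd queries (submit a set of items, receive as the answer whether it is frequent), output the list of all maximal frequent itemsets (equivalently, identify the frequency predicate). Algorithms are multi-tape Turing machines with an oracle that answers crowd queries, and time is the number of steps; a query is one step. For $B_n=\{0,1\}^n$ with the componentwise order and $X,Y\subseteq B_n$, let $T(X)=\{y\in B_n:\exists z\in X,\ z\le y\}$ and $F(Y)=\{y\in B_n:\exists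 z\in Y,\ y\le z\}$. Problem EQ is: given $n$ and (lists of the elements of) $X,Y\subseteq B_n$ such that $T(X)\cap F(Y)=\emptyset$, decide whether $T(X)\cup F(Y)=B_n$. **Proposition.** Let $0<\Theta<1$. Suppose that MineFreq can be solved in time polynomial in $|MII|$, $|MFI|$ and $|\Psi|$, i.e. there are one such oracle machine and one polynomial $p$ such that, for every taxonomy $\Psi$ and every database $D$, the machine solves the problem in at most $p(|MII|,|MFI|,|\Psi|)$ steps. Then problem EQ can be decided by a (deterministic, multi-tape) Turing machine in time polynomial in the length of its input. -/

import Mathlib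

open Turing

noncomputable section

/-! ### Taxonomies, itemsets, databases, frequency

The items form a finite type `I`; the taxonomy is its partial order, where `i ≤ i'` means that `i'`
is more specific than `i`. -/

/-- Every item of `A` is implied by some item of `B`. -/
def Implied {I : Type} [PartialOrder I] (A B : Finset I) : Prop :=
  ∀ i ∈ A, ∃ j ∈ B, i ≤ j

/-- The elements of the itemset taxonomy: antichains of items. -/
def Itemset (I : Type) [PartialOrder I] : Type :=
  {A : Finset I // IsAntichain (· ≤ ·) (A : Set I)}

/-- The itemset taxonomy: antichains of items, ordered by `Implied`. -/
instance Itemset.instPartialOrder (I : Type) [PartialOrder I] : PartialOrder (Itemset I) where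
  le A B := Implied A.1 B.1
  le_refl _ i hi := ⟨i, hi, le_rfl⟩
  le_trans A B C hAB hBC i hi := by
    obtain ⟨j, hj, hij⟩ := hAB i hi
    obtain ⟨k, hk, hjk⟩ := hBC j hj
    exact ⟨k, hk, hij.trans hjk⟩
  le_antisymm := by
    have key : ∀ A B : Itemset I, Implied A.1 B.1 → Implied B.1 A.1 → A.1 ⊆ B.1 := by
      intro A B hAB hBA i hi
      obtain ⟨j, hj, hij⟩ := hAB i hi
      obtain ⟨k, hk, hjk⟩ := hBA j hj
      have hik : i = k := A.2.eq hi hk (hij.trans hjk)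
      have hji : i = j := le_antisymm hij (hik ▸ hjk)
      exact hji ▸ hj
    intro A B hAB hBA
    exact Subtype.ext (Finset.Subset.antisymm (key A B hAB hBA) (key B A hBA hAB))

open Classical in
/-- The support of an itemset `A` in the database `D` (a multiset of transactions): the fraction of
the transactions that imply `A`. It is `0` for the empty database. -/
def support {I : Type} [PartialOrder I] (D : Multiset (Finset I)) (A : Finset I) : ℝ :=
  (D.filter (fun T => Implied A T)).card / D.card

/-- `A` is frequent in `D`: its support exceeds the threshold `Θ`. -/
def Freq {I : Type} [PartialOrder I] (Θ : ℝ) (D : Multiset (Finset I)) (A : Finset I) : Prop :=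
  Θ < support D A

/-- The maximal frequent itemsets of `D`. -/
def MFI {I : Type} [PartialOrder I] (Θ : ℝ) (D : Multiset (Finset I)) : Set (Itemset I) :=
  {A | Maximal (fun B : Itemset I => Freq Θ D B.1) A}

/-- The minimal infrequent itemsets of `D`. -/
def MII {I : Type} [PartialOrder I] (Θ : ℝ) (D : Multiset (Finset I)) : Set (Itemset I) :=
  {A | Minimal (fun B : Itemset I => ¬ Freq Θ D B.1) A}

/-- The size of the taxonomy: the number of items plus the number of pairs in the covering
relation. -/
def taxonomySize (I : Type) [PartialOrder I] : ℕ :=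
  Nat.card I + {q : I × I | q.1 ⋖ q.2}.ncard

/-! ### Encodings as words -/

/-- The input, output and query alphabet. -/
inductive Letter : Type
  | zero
  | one
  | comma
  | bar
  deriving DecidableEq

/-- A Boolean vector, written as a word of length `n`. -/
def encodeVec {n : ℕ} (v : Fin n → Bool) : List Letter :=
  (List.ofFn v).map (fun b => if b then Letter.one else Letter.zero)

/-- A list of Boolean vectors, each one followed by a comma. -/
def encodeVecs {n : ℕ} (X : List (Fin n → Bool)) : List Letter :=
  X.flatMap (fun v => encodeVec v ++ [Letter.comma])

open Classical in
/-- The characteristic vector of an itemset, with respect to an enumeration of the items. -/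
def charVec {I : Type} {n : ℕ} (e : Fin n ≃ I) (A : Finset I) : Fin n → Bool :=
  fun i => decide (e i ∈ A)

open Classical in
/-- The taxonomy, written as a directed acyclic graph: the number of items in unary, followed by the
list of the pairs of the covering relation (pairs of item numbers in unary). -/
def encodeTaxonomy {I : Type} [PartialOrder I] {n : ℕ} (e : Fin n ≃ I) : List Letter :=
  List.replicate n Letter.one ++ [Letter.bar] ++
    (((List.finRange n).product (List.finRange n)).filter
      (fun q => decide (e q.1 ⋖ e q.2))).flatMap
        (fun q => List.replicate (q.1 : ℕ) Letter.one ++ [Letter.comma] ++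
          List.replicate (q.2 : ℕ) Letter.one ++ [Letter.bar])

/-- The itemset denoted by a query word: item number `i` belongs to it iff the letter number `i` of
the word is `one`. The word `encodeVec (charVec e A)` denotes `A`. -/
def decodeItemset {I : Type} {n : ℕ} (e : Fin n ≃ I) (w : List Letter) : Finset I :=
  (Finset.univ.filter (fun i : Fin n => w[(i : ℕ)]? = some Letter.one)).map e.toEmbedding

/-! ### Interactive algorithms: multi-stack machines with crowd queries -/

/-- An oracle Turing machine: a machine of Mathlib's multi-stack model, with a query
stack and three distinguished labels. At the label `ask` the word on the query stack is submitted to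
the oracle. -/
structure CrowdMachine extends TM2ComputableAux Letter Letter where
  queryStack : tm.K
  queryAlphabet : tm.Γ queryStack ≃ Letter
  ask : tm.Λ
  yes : tm.Λ
  no : tm.Λ

/-- The configurations: the current label (`none` once the machine has halted), the internal state
and the contents of the stacks. -/
abbrev CrowdMachine.Cfg (M : CrowdMachine) : Type :=
  TM2.Cfg M.tm.Γ M.tm.Λ M.tm.σ

open Classical in
/-- One step of computation. At the label `ask`, the machine jumps to `yes` or `no` according to the
answer of the oracle to the word on the query stack, and the query stack is erased. At any other
label, the program of the machine is executed. -/
def CrowdMachine.step (M : CrowdMachine) (oracle : List Letter → Prop) (c : M.Cfg) : Option M.Cfg :=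
  if c.l = some M.ask then
    some
      { l := some (if oracle ((c.stk M.queryStack).map M.queryAlphabet) then M.yes else M.no)
        var := c.var
        stk := Function.update c.stk M.queryStack [] }
  else TM2.step M.tm.m c

/-- Started on the word `input`, with access to the given oracle, the machine halts after at most `t`
steps, with the word `output` on its output stack. -/
def CrowdMachine.OutputsInTime (M : CrowdMachine) (oracle : List Letter → Prop)
    (input output : List Letter) (t : ℕ) : Prop :=
  ∃ c : M.Cfg, c.l = none ∧ (c.stk M.tm.k₁).map M.outputAlphabet = output ∧
    Nonempty (StateTransition.EvalsToInTime (M.step oracle)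
      (initList M.tm (input.map M.inputAlphabet.symm)) (some c) t)

/-- `MineFreq` (with threshold `Θ`) can be solved in time polynomial in the numbers of minimal
infrequent itemsets and of maximal frequent itemsets and in the size of the taxonomy: a single
machine, given any finite taxonomy as its input, and having access to an unknown database `D` only
through crowd queries, lists the maximal frequent itemsets of `D`. -/
def MineFreqSolvableInPolyTime (Θ : ℝ) : Prop :=
  ∃ (M : CrowdMachine) (p : MvPolynomial (Fin 3) ℕ),
    ∀ (I : Type) [PartialOrder I] (n : ℕ) (e : Fin n ≃ I) (D : Multiset (Finset I)),
      ∃ L : List (Itemset I), L.Nodup ∧ (∀ A, A ∈ L ↔ A ∈ MFI Θ D) ∧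
        M.OutputsInTime (fun w => Freq Θ D (decodeItemset e w)) (encodeTaxonomy e)
          (encodeVecs (L.map (fun A => charVec e A.1)))
          (MvPolynomial.eval ![(MII Θ D).ncard, (MFI Θ D).ncard, taxonomySize I] p)

/-! ### Problem EQ -/

/-- `T(X)`: the Boolean vectors above some element of `X`. -/
def upSet {n : ℕ} (X : List (Fin n → Bool)) : Set (Fin n → Bool) :=
  {y | ∃ z ∈ X, z ≤ y}

/-- `F(X)`: the Boolean vectors below some element of `X`. -/
def downSet {n : ℕ} (X : List (Fin n → Bool)) : Set (Fin n → Bool) :=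
  {y | ∃ z ∈ X, y ≤ z}

/-- An instance of problem EQ: two sets of Boolean vectors of length `n`, given as lists, with
`T(X) ∩ F(Y) = ∅`. -/
structure EQInstance where
  n : ℕ
  X : List (Fin n → Bool)
  Y : List (Fin n → Bool)
  disjoint : upSet X ∩ downSet Y = ∅

/-- The length `n` in unary, followed by the vectors of `X` and by the vectors of `Y`. -/
def EQInstance.encode (J : EQInstance) : List Letter :=
  List.replicate J.n Letter.one ++ [Letter.bar] ++ encodeVecs J.X ++ [Letter.bar] ++ encodeVecs J.Y

open Classical in
/-- The answer to an instance of EQ: whether `T(X) ∪ F(Y)` contains all Boolean vectors. -/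
def EQInstance.answer (J : EQInstance) : Bool :=
  decide (upSet J.X ∪ downSet J.Y = Set.univ)

/-- Problem EQ is solvable in polynomial time, by a Turing machine in the sense of Mathlib. -/
def EQSolvableInPolyTime : Prop :=
  Nonempty (TM2ComputableInPolyTime EQInstance.encode (fun b : Bool => [b]) EQInstance.answer)

end

/-! Over an antichain of `n` items the itemsets are all subsets, that is, the vectors of `B_n`, and
any down-set `F(Y)` is the family of frequent sets of some database (`exists_database`). Given an
instance of EQ, run the MineFreq machine on this taxonomy, answer each query by membership in
`F(Y)`, reject as soon as a query lies outside `T(X) ∪ F(Y)`, and reject if a time budget `ℓ ^ (d +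
1) ≥ p(ℓ, ℓ, ℓ)` runs out, where `ℓ` is the length of the instance.

If `T(X) ∪ F(Y)` is everything, no query is bad. Moreover `MFI` embeds in `Y` and `MII` in `X`
(`MFI_ncard_le`, `MII_ncard_le`), so the machine halts within the budget. Conversely, suppose that
it halts after good queries only, but some `u` is uncovered. The complement of `T(X)` is also a
frequency predicate; it gives the same answers to all good queries, so the run and the output are
the same for both. Since the maximal frequent sets determine the predicate, the two predicates would
coincide, yet they differ at `u`. This is `haltsWithin_iff`.

What remains is to carry out this test on a multi-stack machine: build a unary clock, evaluate each
query by scanning `X` and `Y`, and empty the stacks before answering. `reach_prepare`,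
`reach_query`, `reach_simulation` and `reach_clean` verify these with time bounds, and
`reach_answer` combines them. -/

/-! ### The flat taxonomy and threshold databases -/

/-- `n` pairwise incomparable items. -/
def FlatItem (n : ℕ) : Type := Fin n

namespace FlatItem

variable {n : ℕ}

instance : Fintype (FlatItem n) := inferInstanceAs (Fintype (Fin n))

instance : DecidableEq (FlatItem n) := inferInstanceAs (DecidableEq (Fin n))

instance : PartialOrder (FlatItem n) where
  le a b := a = b
  le_refl _ := rfl
  le_trans _ _ _ := Eq.trans
  le_antisymm _ _ h _ := h

theorem le_iff {a b : FlatItem n} : a ≤ b ↔ a = b := Iff.rfl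

/-- The enumeration of the items. -/
def enum (n : ℕ) : Fin n ≃ FlatItem n := Equiv.refl _

theorem implied_iff {A B : Finset (FlatItem n)} : Implied A B ↔ A ⊆ B := by
  simp only [Implied, le_iff]
  exact ⟨fun h i hi => by obtain ⟨j, hj, rfl⟩ := h i hi; exact hj, fun h i hi => ⟨i, h hi, rfl⟩⟩

/-- Every set of items is an itemset. -/
def toItemset (A : Finset (FlatItem n)) : Itemset (FlatItem n) :=
  ⟨A, fun _ _ _ _ hne h => hne h⟩

theorem itemset_le_iff {A B : Itemset (FlatItem n)} : A ≤ B ↔ A.1 ⊆ B.1 := implied_iff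

instance : Finite (Itemset (FlatItem n)) :=
  inferInstanceAs (Finite {A : Finset (FlatItem n) // IsAntichain (· ≤ ·) (A : Set (FlatItem n))})

theorem not_covBy (a b : FlatItem n) : ¬ a ⋖ b := fun h => h.lt.ne h.le

theorem encodeTaxonomy_eq (n : ℕ) :
    encodeTaxonomy (enum n) = List.replicate n Letter.one ++ [Letter.bar] := by
  simp [encodeTaxonomy, not_covBy]

theorem taxonomySize_eq (n : ℕ) : taxonomySize (FlatItem n) = n := by
  simp only [taxonomySize, not_covBy, Set.ofPred_false, Set.ncard_empty, add_zero]
  rw [Nat.card_congr (enum n).symm, Nat.card_fin]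

/-- The set of items with a given characteristic vector. -/
def ofVec (v : Fin n → Bool) : Finset (FlatItem n) :=
  Finset.univ.filter fun i => v ((enum n).symm i) = true

theorem charVec_ofVec (v : Fin n → Bool) : charVec (enum n) (ofVec v) = v := by
  funext i
  simp [charVec, ofVec]

theorem charVec_le_iff {A B : Finset (FlatItem n)} :
    charVec (enum n) A ≤ charVec (enum n) B ↔ A ⊆ B := by
  constructor
  · intro h i hi
    have := h ((enum n).symm i)
    simpa [charVec, hi, Bool.le_iff_imp] using this
  · intro h i
    simpa [charVec, Bool.le_iff_imp] using fun hi => h hi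

theorem charVec_injective : Function.Injective (charVec (enum n)) := fun _ _ h =>
  Finset.Subset.antisymm (charVec_le_iff.1 h.le) (charVec_le_iff.1 h.ge)

end FlatItem

open FlatItem

/-- The sets of `Y` serve as transactions, padded to `N` transactions by `⌊Θ N⌋` full ones and some
empty ones. A nonempty set gets `⌊Θ N⌋` for free, which does not exceed `Θ N`, while one more
occurrence, inside a member of `Y`, does. -/
theorem exists_database {n : ℕ} {Θ : ℝ} (h0 : 0 < Θ) (h1 : Θ < 1) (Y : List (Fin n → Bool)) :
    ∃ D : Multiset (Finset (FlatItem n)),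
      ∀ A, Freq Θ D A ↔ charVec (enum n) A ∈ downSet Y := by
  classical
  rcases eq_or_ne Y [] with rfl | hY
  -- With `Y` empty not even `∅` may be frequent, which forces the empty database: there the support
  -- is `0`.
  · exact ⟨0, fun A => by simp [Freq, support, downSet, h0.le]⟩
  -- This size leaves room for the transactions of `Y` next to the `⌊Θ N⌋` full ones.
  obtain ⟨N, hN⟩ := exists_nat_gt ((Y.length : ℝ) / (1 - Θ))
  have hΘ : 0 < 1 - Θ := by linarith
  have hNpos : (0 : ℝ) < N := lt_of_le_of_lt (by positivity) hN
  have hYN : (Y.length : ℝ) < N * (1 - Θ) := (div_lt_iff₀ hΘ).1 hN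
  set a := ⌊Θ * N⌋₊ with ha
  have ha1 : (a : ℝ) ≤ Θ * N := Nat.floor_le (by positivity)
  have ha2 : Θ * N < a + 1 := Nat.lt_floor_add_one _
  have hle : Y.length + a ≤ N := by
    have : (Y.length : ℝ) + a ≤ N := by linarith
    exact_mod_cast this
  obtain ⟨b, hb⟩ := Nat.exists_eq_add_of_le hle
  refine ⟨((Y.map ofVec : List _) : Multiset _) + Multiset.replicate a Finset.univ +
    Multiset.replicate b ∅, fun A => ?_⟩
  have hcard : (((Y.map ofVec : List _) : Multiset (Finset (FlatItem n))) +
      Multiset.replicate a Finset.univ + Multiset.replicate b ∅).card = N := by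
    simp [hb]
  have hmem : charVec (enum n) A ∈ downSet Y ↔ ∃ y ∈ Y, A ⊆ ofVec y := by
    simp only [downSet, Set.mem_ofPred_eq]
    refine exists_congr fun y => and_congr_right fun _ => ?_
    rw [← charVec_le_iff, charVec_ofVec]
  rw [hmem, Freq, support, hcard, lt_div_iff₀ hNpos]
  -- Only `∅` is also contained in the empty padding transactions; its support is `1`.
  rcases eq_or_ne A ∅ with rfl | hA
  · rw [Multiset.filter_eq_self.2 (by simp [Implied]), hcard]
    obtain ⟨y, hy⟩ := List.exists_mem_of_ne_nil Y hY
    exact iff_of_true (by nlinarith) ⟨y, hy, Finset.empty_subset _⟩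
  · have h2 : (Multiset.replicate b (∅ : Finset (FlatItem n))).filter (fun T => A ⊆ T) = 0 :=
      Multiset.filter_eq_nil.2 fun T hT => by
        rw [Multiset.eq_of_mem_replicate hT, Finset.subset_empty]; exact hA
    have h3 : (Multiset.replicate a (Finset.univ : Finset (FlatItem n))).filter (fun T => A ⊆ T) =
        Multiset.replicate a Finset.univ :=
      Multiset.filter_eq_self.2 fun T hT => by
        rw [Multiset.eq_of_mem_replicate hT]; exact Finset.subset_univ _
    simp only [implied_iff, Multiset.filter_add, h2, h3, Multiset.card_add,
      Multiset.card_replicate, add_zero]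
    have hpos : (∃ y ∈ Y, A ⊆ ofVec y) ↔
        1 ≤ (((Y.map ofVec : List _) : Multiset (Finset (FlatItem n))).filter (A ⊆ ·)).card := by
      rw [Nat.one_le_iff_ne_zero, ← Nat.pos_iff_ne_zero, Multiset.card_pos_iff_exists_mem]
      simp
    rw [hpos]
    generalize (((Y.map ofVec : List _) : Multiset (Finset (FlatItem n))).filter (A ⊆ ·)).card = k
    push_cast
    constructor
    · intro h
      by_contra hk
      obtain rfl : k = 0 := by omega
      norm_num at h
      linarith
    · intro h
      have : (1 : ℝ) ≤ k := by exact_mod_cast h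
      linarith

/-! ### Frequency predicates on the flat taxonomy -/

section FlatFrequency

variable {n : ℕ} {Θ : ℝ} {D : Multiset (Finset (FlatItem n))} {X Y : List (Fin n → Bool)}

theorem downSet_of_le {u v : Fin n → Bool} (h : u ≤ v) (hv : v ∈ downSet Y) : u ∈ downSet Y := by
  obtain ⟨z, hz, hvz⟩ := hv
  exact ⟨z, hz, h.trans hvz⟩

theorem upSet_of_le {u v : Fin n → Bool} (h : u ≤ v) (hu : u ∈ upSet X) : v ∈ upSet X := by
  obtain ⟨z, hz, hzu⟩ := hu
  exact ⟨z, hz, hzu.trans h⟩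

theorem mem_MFI {A : Itemset (FlatItem n)} :
    A ∈ MFI Θ D ↔ Maximal (fun B : Itemset (FlatItem n) => Freq Θ D B.1) A := Iff.rfl

theorem mem_MII {A : Itemset (FlatItem n)} :
    A ∈ MII Θ D ↔ Minimal (fun B : Itemset (FlatItem n) => ¬ Freq Θ D B.1) A := Iff.rfl

/-- In a finite order every frequent set lies below a maximal one, and frequency is inherited
downwards. Hence the output of the algorithm determines the predicate. -/
theorem freq_iff_exists_mem_MFI (hD : ∀ A, Freq Θ D A ↔ charVec (enum n) A ∈ downSet Y)
    (A : Finset (FlatItem n)) : Freq Θ D A ↔ ∃ B ∈ MFI Θ D, A ⊆ B.1 := by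
  constructor
  · intro h
    obtain ⟨B, hAB, hB⟩ := Set.Finite.exists_le_maximal
      (s := {B : Itemset (FlatItem n) | Freq Θ D B.1}) (Set.toFinite _) (a := toItemset A) h
    exact ⟨B, hB, itemset_le_iff.1 hAB⟩
  · rintro ⟨B, hB, hAB⟩
    exact (hD A).2 (downSet_of_le (charVec_le_iff.2 hAB) ((hD B.1).1 (mem_MFI.1 hB).prop))

/-- A maximal frequent set lies below some member of `Y`, which is itself frequent, so the two are
equal. -/
theorem MFI_ncard_le (hD : ∀ A, Freq Θ D A ↔ charVec (enum n) A ∈ downSet Y) :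
    (MFI Θ D).ncard ≤ Y.length := by
  classical
  have hsub : MFI Θ D ⊆ ((Y.map fun y => toItemset (ofVec y)).toFinset : Set _) := by
    intro A hA
    rw [mem_MFI] at hA
    obtain ⟨y, hy, hAy⟩ := (hD A.1).1 hA.prop
    have hle : A ≤ toItemset (ofVec y) := by
      rw [itemset_le_iff, ← charVec_le_iff]
      simpa [toItemset, charVec_ofVec] using hAy
    have hf : Freq Θ D (toItemset (ofVec y)).1 :=
      (hD _).2 ⟨y, hy, (charVec_ofVec y).le⟩
    simpa using ⟨y, hy, (hA.eq_of_le hf hle).symm⟩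
  calc (MFI Θ D).ncard ≤ _ := Set.ncard_le_ncard hsub
    _ ≤ _ := by
      rw [Set.ncard_coe_finset]
      exact (List.toFinset_card_le _).trans (by simp)

/-- Covering puts a minimal infrequent set above some member of `X`; disjointness makes that member
infrequent, so the two are equal. This is where a positive instance guarantees a short run. -/
theorem MII_ncard_le (hD : ∀ A, Freq Θ D A ↔ charVec (enum n) A ∈ downSet Y)
    (hdisj : upSet X ∩ downSet Y = ∅) (hcover : upSet X ∪ downSet Y = Set.univ) :
    (MII Θ D).ncard ≤ X.length := by
  classical
  have hsub : MII Θ D ⊆ ((X.map fun x => toItemset (ofVec x)).toFinset : Set _) := by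
    intro A hA
    rw [mem_MII] at hA
    have hA' : charVec (enum n) A.1 ∈ upSet X := by
      have : charVec (enum n) A.1 ∈ upSet X ∪ downSet Y := hcover ▸ Set.mem_univ _
      exact this.resolve_right fun h => hA.prop ((hD _).2 h)
    obtain ⟨x, hx, hxA⟩ := hA'
    have hle : toItemset (ofVec x) ≤ A := by
      rw [itemset_le_iff, ← charVec_le_iff]
      simpa [toItemset, charVec_ofVec] using hxA
    have hf : ¬ Freq Θ D (toItemset (ofVec x)).1 := fun h => by
      have h2 : charVec (enum n) (ofVec x) ∈ upSet X ∩ downSet Y :=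
        ⟨⟨x, hx, (charVec_ofVec x).ge⟩, (hD _).1 h⟩
      rw [hdisj] at h2
      exact h2
    simpa using ⟨x, hx, (hA.eq_of_ge hf hle).symm⟩
  calc (MII Θ D).ncard ≤ _ := Set.ncard_le_ncard hsub
    _ ≤ _ := by
      rw [Set.ncard_coe_finset]
      exact (List.toFinset_card_le _).trans (by simp)

/-- The vector denoted by a query word. -/
def wordVec (n : ℕ) (w : List Letter) : Fin n → Bool := fun i => decide (w[(i : ℕ)]? = some .one)

theorem charVec_decodeItemset (w : List Letter) :
    charVec (enum n) (decodeItemset (enum n) w) = wordVec n w := by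
  funext i
  simp [charVec, decodeItemset, wordVec]

end FlatFrequency

/-! ### Injectivity and length of the encodings -/

theorem encodeVec_length {n : ℕ} (v : Fin n → Bool) : (encodeVec v).length = n := by
  simp [encodeVec]

theorem encodeVec_injective {n : ℕ} : Function.Injective (encodeVec (n := n)) := by
  intro u v h
  refine List.ofFn_injective (List.map_injective_iff.2 ?_ h)
  intro a b
  cases a <;> cases b <;> simp

theorem encodeVecs_injective {n : ℕ} : Function.Injective (encodeVecs (n := n)) := by
  intro X
  induction X with
  | nil =>
    intro Y h
    cases Y with
    | nil => rfl
    | cons y Y => simp [encodeVecs] at h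
  | cons x X ih =>
    intro Y h
    cases Y with
    | nil => simp [encodeVecs] at h
    | cons y Y =>
      simp only [encodeVecs, List.flatMap_cons] at h
      obtain ⟨h1, h2⟩ := List.append_inj h (by simp [encodeVec_length])
      rw [encodeVec_injective (List.append_inj_left' h1 rfl), ih h2]

theorem encodeVecs_length {n : ℕ} (X : List (Fin n → Bool)) :
    (encodeVecs X).length = X.length * (n + 1) := by
  induction X with
  | nil => simp [encodeVecs]
  | cons x X ih =>
    simp only [encodeVecs, List.flatMap_cons, List.length_append, List.length_cons] at ih ⊢
    rw [ih, encodeVec_length]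
    simp
    ring

/-! ### Runs of an interactive algorithm -/

namespace CrowdMachine

variable (M : CrowdMachine)

/-- The word that is submitted when a query is asked. -/
def queryWord (c : M.Cfg) : List Letter := (c.stk M.queryStack).map M.queryAlphabet

/-- From the configuration `c`, the machine halts after at most `t` steps, and all the words that it
submits satisfy `good`. -/
inductive HaltsWithin (oracle good : List Letter → Prop) : ℕ → M.Cfg → Prop
  | halted (t : ℕ) (c : M.Cfg) (hc : c.l = none) : HaltsWithin oracle good t c
  | step (t : ℕ) (c c' : M.Cfg) (hstep : M.step oracle c = some c')
      (hgood : c.l = some M.ask → good (M.queryWord c)) (h : HaltsWithin oracle good t c') :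
      HaltsWithin oracle good (t + 1) c

variable {M}

theorem step_eq_none {oracle : List Letter → Prop} {c : M.Cfg} (h : c.l = none) :
    M.step oracle c = none := by
  obtain ⟨l, v, S⟩ := c
  obtain rfl : l = none := h
  simp [step]

theorem iterate_none {α : Type*} (f : α → Option α) (s : ℕ) :
    (flip bind f)^[s] (none : Option α) = none := by
  induction s with
  | zero => rfl
  | succ s ih => exact ih

theorem iterate_succ {α : Type*} (f : α → Option α) (s : ℕ) (a : α) :
    (flip bind f)^[s + 1] (some a) = (flip bind f)^[s] (f a) := rfl

theorem haltsWithin_of_iterate {oracle good : List Letter → Prop} (hgood : ∀ w, good w) {s t : ℕ}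
    (hst : s ≤ t) {c c' : M.Cfg} (hc' : c'.l = none)
    (h : (flip bind (M.step oracle))^[s] (some c) = some c') : M.HaltsWithin oracle good t c := by
  induction s generalizing c t with
  | zero =>
    obtain rfl : c = c' := by simpa using h
    exact .halted _ _ hc'
  | succ s ih =>
    rw [iterate_succ] at h
    cases hs : M.step oracle c with
    | none => rw [hs, iterate_none] at h; cases h
    | some d =>
      obtain ⟨t, rfl⟩ : ∃ u, t = u + 1 := ⟨t - 1, by omega⟩
      exact .step _ _ d hs (fun _ => hgood _) (ih (by omega) (hs ▸ h))

/-- An oracle influences a run only through its answers to the submitted words. If two oracles agree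
on these, the runs coincide step by step. -/
theorem HaltsWithin.exists_iterate {o₁ o₂ good : List Letter → Prop}
    (hagree : ∀ w, good w → (o₁ w ↔ o₂ w)) {t : ℕ} {c : M.Cfg} (h : M.HaltsWithin o₁ good t c) :
    ∃ (s : ℕ) (c' : M.Cfg), c'.l = none ∧ (flip bind (M.step o₁))^[s] (some c) = some c' ∧
      (flip bind (M.step o₂))^[s] (some c) = some c' := by
  induction h with
  | halted t c hc => exact ⟨0, c, hc, rfl, rfl⟩
  | step t c d hs hg _ ih =>
    obtain ⟨s, c', hc', h1, h2⟩ := ih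
    have hs2 : M.step o₂ c = some d := by
      rw [← hs]
      unfold CrowdMachine.step
      by_cases hask : c.l = some M.ask
      · have hw := hagree _ (hg hask)
        rw [queryWord] at hw
        by_cases h : o₂ ((c.stk M.queryStack).map M.queryAlphabet)
        · simp [hask, h, hw.2 h]
        · simp [hask, h, mt hw.1 h]
      · simp only [hask, if_false]
    exact ⟨s + 1, c', hc', by rw [iterate_succ, hs, h1], by rw [iterate_succ, hs2, h2]⟩

theorem halted_unique {oracle : List Letter → Prop} {c c₁ c₂ : M.Cfg} {s₁ s₂ : ℕ}
    (h₁ : (flip bind (M.step oracle))^[s₁] (some c) = some c₁) (hc₁ : c₁.l = none)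
    (h₂ : (flip bind (M.step oracle))^[s₂] (some c) = some c₂) (hc₂ : c₂.l = none) : c₁ = c₂ := by
  induction s₁ generalizing c s₂ with
  | zero =>
    obtain rfl : c = c₁ := by simpa using h₁
    cases s₂ with
    | zero => simpa using h₂
    | succ s₂ => rw [iterate_succ, step_eq_none hc₁, iterate_none] at h₂; cases h₂
  | succ s₁ ih =>
    cases s₂ with
    | zero =>
      obtain rfl : c = c₂ := by simpa using h₂
      rw [iterate_succ, step_eq_none hc₂, iterate_none] at h₁; cases h₁
    | succ s₂ =>
      rw [iterate_succ] at h₁ h₂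
      cases hs : M.step oracle c with
      | none => rw [hs, iterate_none] at h₁; cases h₁
      | some d => rw [hs] at h₁ h₂; exact ih h₁ h₂

end CrowdMachine

/-! ### The criterion for positive instances -/

theorem MvPolynomial_eval_mono {σ : Type*} (p : MvPolynomial σ ℕ) {f g : σ → ℕ} (h : f ≤ g) :
    MvPolynomial.eval f p ≤ MvPolynomial.eval g p := by
  simp only [MvPolynomial.eval_eq]
  exact Finset.sum_le_sum fun d _ => Nat.mul_le_mul_left _
    (Finset.prod_le_prod' fun i _ => Nat.pow_le_pow_left (h i) _)

theorem EQInstance.length_encode (J : EQInstance) :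
    J.encode.length = J.n + 1 + J.X.length * (J.n + 1) + 1 + J.Y.length * (J.n + 1) := by
  simp [EQInstance.encode, encodeVecs_length]
  ring

/-- The algorithm, with the frequent itemsets of the query oracle being those below a vector of `Y`,
halts in time without a query that is neither above a vector of `X` nor below one of `Y` iff the
instance of EQ is positive. -/
theorem haltsWithin_iff {Θ : ℝ} (h0 : 0 < Θ) (h1 : Θ < 1) {M : CrowdMachine}
    {p : MvPolynomial (Fin 3) ℕ}
    (h : ∀ (I : Type) [PartialOrder I] (n : ℕ) (e : Fin n ≃ I) (D : Multiset (Finset I)),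
      ∃ L : List (Itemset I), L.Nodup ∧ (∀ A, A ∈ L ↔ A ∈ MFI Θ D) ∧
        M.OutputsInTime (fun w => Freq Θ D (decodeItemset e w)) (encodeTaxonomy e)
          (encodeVecs (L.map (fun A => charVec e A.1)))
          (MvPolynomial.eval ![(MII Θ D).ncard, (MFI Θ D).ncard, taxonomySize I] p))
    (J : EQInstance) {t : ℕ}
    (ht : MvPolynomial.eval (fun _ => J.encode.length) p ≤ t) :
    M.HaltsWithin (fun w => wordVec J.n w ∈ downSet J.Y)
      (fun w => wordVec J.n w ∈ upSet J.X ∪ downSet J.Y) t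
      (initList M.tm ((List.replicate J.n Letter.one ++ [Letter.bar]).map M.inputAlphabet.symm)) ↔
    upSet J.X ∪ downSet J.Y = Set.univ := by
  classical
  obtain ⟨D, hD⟩ := exists_database h0 h1 J.Y
  obtain ⟨L, -, hL, c, hc, hout, ⟨⟨⟨s, hs⟩, hst⟩⟩⟩ := h (FlatItem J.n) J.n (enum J.n) D
  rw [encodeTaxonomy_eq] at hs
  simp only [hD, charVec_decodeItemset] at hs
  constructor
  · intro hw
    by_contra hne
    obtain ⟨u, hu⟩ := (Set.ne_univ_iff_exists_notMem _).1 hne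
    -- The competing predicate: everything outside `T(X)` is frequent. This list may be
    -- exponentially long, but it occurs only in the proof, not in the algorithm.
    set Y' : List (Fin J.n → Bool) := (Finset.univ.filter (· ∉ upSet J.X)).toList
    have hY' : ∀ v, v ∈ downSet Y' ↔ v ∉ upSet J.X := by
      intro v
      constructor
      · rintro ⟨z, hz, hvz⟩ hv
        simp only [Y', Finset.mem_toList, Finset.mem_filter, Finset.mem_univ, true_and] at hz
        exact hz (upSet_of_le hvz hv)
      · intro hv
        exact ⟨v, by simpa [Y'] using hv, le_rfl⟩
    have hdisj : ∀ v, v ∈ downSet J.Y → v ∉ upSet J.X := fun v hv hv' => by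
      have : v ∈ upSet J.X ∩ downSet J.Y := ⟨hv', hv⟩
      rw [J.disjoint] at this
      exact this
    obtain ⟨D', hD'⟩ := exists_database h0 h1 Y'
    obtain ⟨L', -, hL', c', hc', hout', ⟨⟨⟨s', hs'⟩, -⟩⟩⟩ := h (FlatItem J.n) J.n (enum J.n) D'
    rw [encodeTaxonomy_eq] at hs'
    simp only [hD', charVec_decodeItemset] at hs'
    -- On `T(X)` both oracles say no, on `F(Y)` both say yes.
    obtain ⟨r, d, hd, hr1, hr2⟩ := hw.exists_iterate (o₂ := fun w => wordVec J.n w ∈ downSet Y') <| by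
      rintro w (hw | hw)
      · exact iff_of_false (fun h => hdisj _ h hw) (fun h => (hY' _).1 h hw)
      · exact iff_of_true hw ((hY' _).2 (hdisj _ hw))
    obtain rfl := CrowdMachine.halted_unique hs hc hr1 hd
    obtain rfl := CrowdMachine.halted_unique hs' hc' hr2 hd
    have hLL : L = L' := by
      refine (List.map_injective_iff.2 ?_) (encodeVecs_injective (hout.symm.trans hout'))
      exact fun A B hAB => Subtype.ext (charVec_injective hAB)
    have hM : MFI Θ D = MFI Θ D' := by
      ext A
      rw [← hL, ← hL', hLL]
    have key : Freq Θ D (ofVec u) ↔ Freq Θ D' (ofVec u) := by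
      rw [freq_iff_exists_mem_MFI hD, freq_iff_exists_mem_MFI hD', hM]
    rw [hD, hD', charVec_ofVec, hY'] at key
    exact hu (or_iff_not_imp_left.2 key.2)
  · intro hcover
    refine CrowdMachine.haltsWithin_of_iterate (fun w => hcover ▸ Set.mem_univ _)
      ((hst.trans (MvPolynomial_eval_mono p ?_)).trans ht) hc hs
    have hlen := J.length_encode
    intro i
    change _ ≤ J.encode.length
    fin_cases i
    · refine (MII_ncard_le hD J.disjoint hcover).trans ?_
      have := Nat.le_mul_of_pos_right J.X.length J.n.succ_pos
      simp only [Nat.succ_eq_add_one] at this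
      omega
    · refine (MFI_ncard_le hD).trans ?_
      have := Nat.le_mul_of_pos_right J.Y.length J.n.succ_pos
      simp only [Nat.succ_eq_add_one] at this
      omega
    · change taxonomySize (FlatItem J.n) ≤ _
      rw [taxonomySize_eq]
      omega

/-! ### The simulating machine -/

instance : Fintype Letter := ⟨{.zero, .one, .comma, .bar}, by rintro ⟨⟩ <;> simp⟩

/-- The stacks of the simulator, besides those of the simulated machine. -/
inductive ExtStack : Type
  -- `inp` holds the instance and `aux` the reversed part already read; `clk` is the unary time
  -- budget and `clk2` its next value under construction; `saved` keeps the query letters popped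
  -- during a comparison.
  | inp
  | aux
  | clk
  | clk2
  | saved
  | out
  deriving DecidableEq

instance : Fintype ExtStack :=
  ⟨{.inp, .aux, .clk, .clk2, .saved, .out}, by rintro ⟨⟩ <;> simp⟩

/-- The part of the input that is being read: the header, the vectors of `X` or the vectors of
`Y`. -/
inductive Mode : Type
  | hdr
  | xs
  | ys
  deriving DecidableEq

instance : Fintype Mode :=
  ⟨{.hdr, .xs, .ys}, by rintro ⟨⟩ <;> simp⟩

/-- The additional internal state of the simulator. -/
structure Ctl : Type where
  -- `cur` and `wcur` are the letters last read, `ok` the comparison with the current vector so far,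
  -- `inX` and `inY` whether some vector has matched, `busy` whether a cleaning pass found a letter,
  -- `ans` the verdict.
  cur : Option Letter
  wcur : Option Letter
  mode : Mode
  ok : Bool
  inX : Bool
  inY : Bool
  busy : Bool
  ans : Bool

noncomputable instance : Fintype Ctl :=
  Fintype.ofInjective
    (fun t => (t.cur, t.wcur, t.mode, t.ok, t.inX, t.inY, t.busy, t.ans)) fun s t h => by
      cases s
      cases t
      simpa using h

/-- The phases of the construction of the clock. -/
inductive MulPhase : Type
  | outer
  | scan
  | back
  | move
  deriving DecidableEq

instance : Fintype MulPhase :=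
  ⟨{.outer, .scan, .back, .move}, by rintro ⟨⟩ <;> simp⟩

/-- The other phases, besides the simulation of the steps without a query. -/
inductive Phase : Type
  | start
  | header
  | scan
  | restore
  | rewind
  | erase
  | clean
  deriving DecidableEq

instance : Fintype Phase :=
  ⟨{.start, .header, .scan, .restore, .rewind, .erase, .clean}, by rintro ⟨⟩ <;> simp⟩

namespace Ctl

/-- The normal internal state. -/
def init : Ctl := ⟨none, none, .hdr, true, false, false, false, true⟩

/-- Forgets the letters just read. -/
def reset (t : Ctl) : Ctl := { t with cur := none, wcur := none }

end Ctl

/-- The next part of the input. -/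
def Mode.next : Mode → Mode
  | .hdr => .xs
  | _ => .ys

/-- The comparison of a letter of a vector with a letter of the query. -/
def Mode.cmp (m : Mode) (z : Letter) (o : Option Letter) : Bool :=
  -- A query letter `none`, past the end of the word, counts as a zero, in accordance with
  -- `wordVec`.
  match m with
  | .hdr => true
  | .xs => decide (z = .one → o = some .one)
  | .ys => decide (o = some .one → z = .one)

/-- The comparison of a vector with a query. -/
def Mode.matchBits (m : Mode) : List Letter → List Letter → Bool
  | [], _ => true
  | z :: bs, w => m.cmp z w.head? && m.matchBits bs w.tail

/-- At the end of a vector, records the result of the comparison with the query. -/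
def Ctl.record (t : Ctl) : Ctl :=
  { t with
    ok := true
    inX := t.inX || (t.ok && decide (t.mode = .xs))
    inY := t.inY || (t.ok && decide (t.mode = .ys)) }

namespace CrowdMachine

variable (M : CrowdMachine) (d : ℕ)

/-- The stack index type of the simulator. -/
abbrev SimK : Type := M.tm.K ⊕ ExtStack

/-- The stack alphabets of the simulator. -/
@[reducible] def SimΓ : M.SimK → Type
  | .inl k => M.tm.Γ k
  | .inr .out => Bool
  | .inr .inp => Letter
  | .inr .aux => Letter
  | .inr .clk => Letter
  | .inr .clk2 => Letter
  | .inr .saved => Letter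

/-- The labels of the simulator. -/
abbrev SimΛ : Type := M.tm.Λ ⊕ (Fin (d + 1) × MulPhase) ⊕ Phase

/-- The internal states of the simulator. -/
abbrev Simσ : Type := M.tm.σ × Ctl

instance : Fintype M.tm.K := M.tm.kFin
instance : Fintype M.tm.Λ := M.tm.ΛFin
instance : Fintype M.tm.σ := M.tm.σFin

/-- The statements of the simulator. -/
abbrev SimStmt : Type := TM2.Stmt M.SimΓ (M.SimΛ d) M.Simσ

variable {M d}

/-- A phase, as a label. -/
abbrev phase (q : Phase) : M.SimΛ d := .inr (.inr q)

/-- A phase of the construction of the clock, as a label. -/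
abbrev mulPhase (j : Fin (d + 1)) (q : MulPhase) : M.SimΛ d := .inr (.inl (j, q))

/-- Acts on the additional state only. -/
abbrev onCtl (f : Ctl → Ctl) : M.Simσ → M.Simσ := fun v => (v.1, f v.2)

/-- Stores the letter just read. -/
abbrev readCur : M.Simσ → Option Letter → M.Simσ := fun v o => (v.1, { v.2 with cur := o })

/-- Resets the state and jumps. -/
def leave (l : M.SimΛ d) : M.SimStmt d := .load (onCtl Ctl.reset) (.goto fun _ => l)

/-- Pops a letter from each of the given stacks, and records whether there was one. -/
def popAll (q : M.SimStmt d) : List M.SimK → M.SimStmt d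
  | [] => q
  | k :: ks => .pop k (fun v o => (v.1, { v.2 with busy := v.2.busy || o.isSome })) (popAll q ks)

/-- The label at which the simulation continues. -/
def contLabel : Option M.tm.Λ → M.SimΛ d
  | none => phase .clean
  | some l => .inl l

/-- The translation of the statements of the simulated machine. -/
def trStmt : TM2.Stmt M.tm.Γ M.tm.Λ M.tm.σ → M.SimStmt d
  | .push k f q => .push (.inl k) (fun v => f v.1) (trStmt q)
  | .peek k f q => .peek (.inl k) (fun v o => (f v.1 o, v.2)) (trStmt q)
  | .pop k f q => .pop (.inl k) (fun v o => (f v.1 o, v.2)) (trStmt q)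
  | .load a q => .load (fun v => (a v.1, v.2)) (trStmt q)
  | .branch p q₁ q₂ => .branch (fun v => p v.1) (trStmt q₁) (trStmt q₂)
  | .goto l => .goto fun v => contLabel (some (l v.1))
  | .halt => .goto fun _ => contLabel none

/-- The label after a round of the construction of the clock. -/
def nextRound : Fin (d + 1) → M.SimΛ d
  | ⟨0, _⟩ => contLabel (some M.tm.main)
  | ⟨i + 1, h⟩ => mulPhase ⟨i, by omega⟩ .outer

open Classical in
/-- The program of the simulator. -/
noncomputable def prog : M.SimΛ d → M.SimStmt d
  | .inr (.inr .start) =>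
    -- The bar ends the simulated input, so it goes to the bottom of the stack. The clock starts at
    -- `1`.
    .push (.inl M.tm.k₀) (fun _ => M.inputAlphabet.symm .bar) <|
    .push (.inr .clk) (fun _ => Letter.one) <| leave (phase .header)
  | .inr (.inr .header) =>
    .pop (.inr .inp) readCur <|
    .branch (fun v => decide (v.2.cur = some .one))
      (.push (.inl M.tm.k₀) (fun _ => M.inputAlphabet.symm .one) <|
        .push (.inr .aux) (fun _ => Letter.one) <| leave (phase .header))
      -- Entering the first round at `back` restores the header from `aux` before the multiplication
      -- begins.
      (.push (.inr .inp) (fun _ => Letter.bar) <| leave (mulPhase (Fin.last d) .back))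
  | .inr (.inl (j, .outer)) =>
    -- Each letter of `clk` triggers a pass over the input that adds `ℓ` letters to `clk2`; a round
    -- multiplies the clock by `ℓ`.
    .pop (.inr .clk) readCur <|
    .branch (fun v => v.2.cur.isSome) (leave (mulPhase j .scan)) (leave (mulPhase j .move))
  | .inr (.inl (j, .scan)) =>
    .pop (.inr .inp) readCur <|
    .branch (fun v => v.2.cur.isSome)
      (.push (.inr .aux) (fun v => v.2.cur.getD .one) <|
        .push (.inr .clk2) (fun _ => Letter.one) <| leave (mulPhase j .scan))
      (leave (mulPhase j .back))
  | .inr (.inl (j, .back)) =>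
    .pop (.inr .aux) readCur <|
    .branch (fun v => v.2.cur.isSome)
      (.push (.inr .inp) (fun v => v.2.cur.getD .one) <| leave (mulPhase j .back))
      (leave (mulPhase j .outer))
  | .inr (.inl (j, .move)) =>
    .pop (.inr .clk2) readCur <|
    .branch (fun v => v.2.cur.isSome)
      (.push (.inr .clk) (fun _ => Letter.one) <| leave (mulPhase j .move))
      (leave (nextRound j))
  | .inl l =>
    -- Every simulated step, queries included, costs one clock letter; an empty clock means
    -- rejection.
    .pop (.inr .clk) readCur <|
    .branch (fun v => v.2.cur.isSome)
      (.load (onCtl Ctl.reset) <| if l = M.ask then leave (phase .scan) else trStmt (M.tm.m l))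
      (.load (onCtl fun t => { t with ans := false }) <| leave (phase .clean))
  | .inr (.inr .scan) =>
    .pop (.inr .inp) readCur <|
    .branch (fun v => v.2.cur.isSome)
      (.push (.inr .aux) (fun v => v.2.cur.getD .one) <|
        .branch (fun v => decide (v.2.cur = some .bar))
          (.load (onCtl fun t => { t with mode := t.mode.next }) <| leave (phase .scan)) <|
        .branch (fun v => decide (v.2.cur = some .comma))
          (.load (onCtl Ctl.record) <| leave (phase .restore)) <|
        .branch (fun v => decide (v.2.mode = .hdr)) (leave (phase .scan)) <|
        .pop (.inl M.queryStack)
          (fun v o => (v.1, { v.2 with wcur := o.map M.queryAlphabet })) <|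
        .load (onCtl fun t =>
          { t with ok := t.ok && t.mode.cmp (t.cur.getD .one) t.wcur }) <|
        .branch (fun v => v.2.wcur.isSome)
          (.push (.inr .saved) (fun v => v.2.wcur.getD .one) <| leave (phase .scan))
          (leave (phase .scan)))
      (.load (onCtl fun t => { t with mode := .hdr }) <| leave (phase .rewind))
  | .inr (.inr .restore) =>
    .pop (.inr .saved) readCur <|
    .branch (fun v => v.2.cur.isSome)
      (.push (.inl M.queryStack) (fun v => M.queryAlphabet.symm (v.2.cur.getD .one)) <|
        leave (phase .restore))
      (leave (phase .scan))
  | .inr (.inr .rewind) =>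
    .pop (.inr .aux) readCur <|
    .branch (fun v => v.2.cur.isSome)
      (.push (.inr .inp) (fun v => v.2.cur.getD .one) <| leave (phase .rewind))
      (leave (phase .erase))
  | .inr (.inr .erase) =>
    .pop (.inl M.queryStack) (fun v o => (v.1, { v.2 with cur := o.map M.queryAlphabet })) <|
    .branch (fun v => v.2.cur.isSome) (leave (phase .erase)) <|
    -- The oracle is membership in `F(Y)`, hence `yes` here. A query matched on neither side is
    -- uncovered and leads to rejection.
    .branch (fun v => v.2.inY)
      (.load (onCtl fun _ => Ctl.init) <| .goto fun _ => contLabel (some M.yes)) <|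
    .branch (fun v => v.2.inX)
      (.load (onCtl fun _ => Ctl.init) <| .goto fun _ => contLabel (some M.no)) <|
    .load (onCtl fun _ => { Ctl.init with ans := false }) <| .goto fun _ => phase .clean
  | .inr (.inr .clean) =>
    -- The final configuration must have all stacks but the output empty and the initial internal
    -- state. Each pass pops every stack once.
    popAll
      (.branch (fun v => v.2.busy)
        (.load (onCtl fun t => { t with busy := false }) <| .goto fun _ => phase .clean)
        (.push (.inr .out) (fun v => v.2.ans) <|
          .load (fun _ => (M.tm.initialState, Ctl.init)) .halt))
      Finset.univ.toList

/-- The contents of the additional stacks. -/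
structure Ext : Type where
  inp : List Letter
  aux : List Letter
  clk : List Letter
  clk2 : List Letter
  saved : List Letter

/-- The contents of all the stacks. -/
def stk (S : ∀ k, List (M.tm.Γ k)) (E : Ext) : ∀ k, List (M.SimΓ k)
  | .inl k => S k
  | .inr .out => []
  | .inr .inp => E.inp
  | .inr .aux => E.aux
  | .inr .clk => E.clk
  | .inr .clk2 => E.clk2
  | .inr .saved => E.saved

section stk

variable (S : ∀ k, List (M.tm.Γ k)) (i a c e s : List Letter)

theorem stk_inl (k : M.tm.K) : stk S ⟨i, a, c, e, s⟩ (.inl k) = S k := rfl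
theorem stk_inp : stk S ⟨i, a, c, e, s⟩ (.inr .inp) = i := rfl
theorem stk_aux : stk S ⟨i, a, c, e, s⟩ (.inr .aux) = a := rfl
theorem stk_clk : stk S ⟨i, a, c, e, s⟩ (.inr .clk) = c := rfl
theorem stk_clk2 : stk S ⟨i, a, c, e, s⟩ (.inr .clk2) = e := rfl
theorem stk_saved : stk S ⟨i, a, c, e, s⟩ (.inr .saved) = s := rfl

theorem update_inl (k : M.tm.K) (x : List (M.tm.Γ k)) :
    Function.update (stk S ⟨i, a, c, e, s⟩) (.inl k) x = stk (Function.update S k x) ⟨i, a, c, e, s⟩ := by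
  funext j
  rcases j with j | j
  · by_cases h : j = k
    · subst h; simp [stk]
    · simp [stk, h]
  · rw [Function.update_of_ne (by simp)]; cases j <;> rfl

theorem update_inp (x : List Letter) :
    Function.update (stk S ⟨i, a, c, e, s⟩) (.inr .inp) x = stk S ⟨x, a, c, e, s⟩ := by
  funext j
  rcases j with j | j
  · rfl
  · cases j <;> rfl

theorem update_aux (x : List Letter) :
    Function.update (stk S ⟨i, a, c, e, s⟩) (.inr .aux) x = stk S ⟨i, x, c, e, s⟩ := by
  funext j
  rcases j with j | j
  · rfl
  · cases j <;> rfl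

theorem update_saved (x : List Letter) :
    Function.update (stk S ⟨i, a, c, e, s⟩) (.inr .saved) x = stk S ⟨i, a, c, e, x⟩ := by
  funext j
  rcases j with j | j
  · rfl
  · cases j <;> rfl

theorem update_clk (x : List Letter) :
    Function.update (stk S ⟨i, a, c, e, s⟩) (.inr .clk) x = stk S ⟨i, a, x, e, s⟩ := by
  funext j
  rcases j with j | j
  · rfl
  · cases j <;> rfl

theorem update_clk2 (x : List Letter) :
    Function.update (stk S ⟨i, a, c, e, s⟩) (.inr .clk2) x = stk S ⟨i, a, c, x, s⟩ := by
  funext j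
  rcases j with j | j
  · rfl
  · cases j <;> rfl

end stk

/-- The configurations of the simulator. -/
abbrev SimCfg (M : CrowdMachine) (d : ℕ) : Type := TM2.Cfg M.SimΓ (M.SimΛ d) M.Simσ

/-- A configuration of the simulator. -/
def cfg (l : M.SimΛ d) (x : M.tm.σ) (t : Ctl) (S : ∀ k, List (M.tm.Γ k)) (E : Ext) :
    M.SimCfg d := ⟨some l, (x, t), stk S E⟩

/-- The simulator goes from `a` to `b` in at most `t` steps. -/
def Reach (t : ℕ) (a b : M.SimCfg d) : Prop :=
  ∃ s ≤ t, (flip bind (TM2.step prog))^[s] (some a) = some b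

theorem Reach.refl (t : ℕ) (a : M.SimCfg d) : Reach t a a := ⟨0, t.zero_le, rfl⟩

theorem Reach.mono {t u : ℕ} {a b : M.SimCfg d} (h : Reach t a b) (htu : t ≤ u) : Reach u a b := by
  obtain ⟨s, hs, e⟩ := h
  exact ⟨s, hs.trans htu, e⟩

theorem Reach.trans {t u : ℕ} {a b c : M.SimCfg d} (h : Reach t a b) (h' : Reach u b c) :
    Reach (t + u) a c := by
  obtain ⟨s, hs, e⟩ := h
  obtain ⟨s', hs', e'⟩ := h'
  exact ⟨s' + s, by omega, by rw [Function.iterate_add_apply, e, e']⟩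

theorem Reach.single {a b : M.SimCfg d} (h : TM2.step prog a = some b) : Reach 1 a b :=
  ⟨1, le_rfl, h⟩

theorem Reach.head {t : ℕ} {a b c : M.SimCfg d} (h : TM2.step prog a = some b) (h' : Reach t b c) :
    Reach (t + 1) a c := by
  rw [add_comm]
  exact (Reach.single h).trans h'

/-! ### Single steps of the simulator -/

section Step

variable (x : M.tm.σ) (S : ∀ k, List (M.tm.Γ k)) (l a c e s : List Letter)
  (z : Letter) (t : Ctl)

theorem step_start :
    TM2.step prog (cfg (d := d) (phase .start) x .init S ⟨l, a, c, e, s⟩) =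
      some (cfg (phase .header) x .init
        (Function.update S M.tm.k₀ (M.inputAlphabet.symm .bar :: S M.tm.k₀))
        ⟨l, a, .one :: c, e, s⟩) := by
  simp [cfg, prog, leave, stk_inl, stk_clk, update_inl, update_clk, Ctl.reset, Ctl.init]

theorem step_header_one :
    TM2.step prog (cfg (d := d) (phase .header) x .init S ⟨.one :: l, a, c, e, s⟩) =
      some (cfg (phase .header) x .init
        (Function.update S M.tm.k₀ (M.inputAlphabet.symm .one :: S M.tm.k₀))
        ⟨l, .one :: a, c, e, s⟩) := by
  simp [cfg, prog, leave, stk_inl, stk_inp, stk_aux, update_inl, update_inp, update_aux,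
    Ctl.reset, Ctl.init]

theorem step_header_bar :
    TM2.step prog (cfg (d := d) (phase .header) x .init S ⟨.bar :: l, a, c, e, s⟩) =
      some (cfg (mulPhase (Fin.last d) .back) x .init S ⟨.bar :: l, a, c, e, s⟩) := by
  simp [cfg, prog, leave, stk_inp, update_inp, Ctl.reset, Ctl.init]

variable (j : Fin (d + 1))

theorem step_mulOuter_cons :
    TM2.step prog (cfg (mulPhase j .outer) x .init S ⟨l, a, z :: c, e, s⟩) =
      some (cfg (mulPhase j .scan) x .init S ⟨l, a, c, e, s⟩) := by
  simp [cfg, prog, leave, stk_clk, update_clk, Ctl.reset, Ctl.init]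

theorem step_mulOuter_nil :
    TM2.step prog (cfg (mulPhase j .outer) x .init S ⟨l, a, [], e, s⟩) =
      some (cfg (mulPhase j .move) x .init S ⟨l, a, [], e, s⟩) := by
  simp [cfg, prog, leave, stk_clk, update_clk, Ctl.reset, Ctl.init]

theorem step_mulScan_cons :
    TM2.step prog (cfg (mulPhase j .scan) x .init S ⟨z :: l, a, c, e, s⟩) =
      some (cfg (mulPhase j .scan) x .init S ⟨l, z :: a, c, .one :: e, s⟩) := by
  simp [cfg, prog, leave, stk_inp, stk_aux, stk_clk2, update_inp, update_aux, update_clk2,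
    Ctl.reset, Ctl.init]

theorem step_mulScan_nil :
    TM2.step prog (cfg (mulPhase j .scan) x .init S ⟨[], a, c, e, s⟩) =
      some (cfg (mulPhase j .back) x .init S ⟨[], a, c, e, s⟩) := by
  simp [cfg, prog, leave, stk_inp, update_inp, Ctl.reset, Ctl.init]

theorem step_mulBack_cons :
    TM2.step prog (cfg (mulPhase j .back) x .init S ⟨l, z :: a, c, e, s⟩) =
      some (cfg (mulPhase j .back) x .init S ⟨z :: l, a, c, e, s⟩) := by
  simp [cfg, prog, leave, stk_inp, stk_aux, update_inp, update_aux, Ctl.reset, Ctl.init]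

theorem step_mulBack_nil :
    TM2.step prog (cfg (mulPhase j .back) x .init S ⟨l, [], c, e, s⟩) =
      some (cfg (mulPhase j .outer) x .init S ⟨l, [], c, e, s⟩) := by
  simp [cfg, prog, leave, stk_aux, update_aux, Ctl.reset, Ctl.init]

theorem step_mulMove_cons :
    TM2.step prog (cfg (mulPhase j .move) x .init S ⟨l, a, c, z :: e, s⟩) =
      some (cfg (mulPhase j .move) x .init S ⟨l, a, .one :: c, e, s⟩) := by
  simp [cfg, prog, leave, stk_clk, stk_clk2, update_clk, update_clk2, Ctl.reset, Ctl.init]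

theorem step_mulMove_nil :
    TM2.step prog (cfg (mulPhase j .move) x .init S ⟨l, a, c, [], s⟩) =
      some (cfg (nextRound j) x .init S ⟨l, a, c, [], s⟩) := by
  simp [cfg, prog, leave, stk_clk2, update_clk2, Ctl.reset, Ctl.init]

theorem step_sim_nil (k : M.tm.Λ) :
    TM2.step prog (cfg (d := d) (.inl k) x .init S ⟨l, a, [], e, s⟩) =
      some (cfg (phase .clean) x { Ctl.init with ans := false } S ⟨l, a, [], e, s⟩) := by
  simp [cfg, prog, leave, stk_clk, update_clk, Ctl.reset, Ctl.init]

theorem step_sim_ask :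
    TM2.step prog (cfg (d := d) (.inl M.ask) x .init S ⟨l, a, z :: c, e, s⟩) =
      some (cfg (phase .scan) x .init S ⟨l, a, c, e, s⟩) := by
  simp [cfg, prog, leave, stk_clk, update_clk, Ctl.reset, Ctl.init]

/-- A translated statement touches only the simulated stacks and state, so it commutes with the
embedding of configurations. -/
theorem stepAux_trStmt (q : TM2.Stmt M.tm.Γ M.tm.Λ M.tm.σ) (E : Ext) :
    TM2.stepAux (trStmt (d := d) q) (x, t) (stk S E) =
      cfg (contLabel (TM2.stepAux q x S).l) (TM2.stepAux q x S).var t (TM2.stepAux q x S).stk E := by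
  obtain ⟨l, a, c, e, s⟩ := E
  induction q generalizing x S with
  | push k f q ih => simp [trStmt, stk_inl, update_inl, ih]
  | peek k f q ih => simp [trStmt, stk_inl, ih]
  | pop k f q ih => simp [trStmt, stk_inl, update_inl, ih]
  | load f q ih => simp [trStmt, ih]
  | branch p q₁ q₂ ih₁ ih₂ => cases h : p x <;> simp [trStmt, h, ih₁, ih₂]
  | goto f => simp [trStmt, cfg]
  | halt => simp [trStmt, cfg]

theorem step_sim {k : M.tm.Λ} (hk : k ≠ M.ask) :
    TM2.step prog (cfg (d := d) (.inl k) x .init S ⟨l, a, z :: c, e, s⟩) =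
      some (cfg (contLabel (TM2.stepAux (M.tm.m k) x S).l) (TM2.stepAux (M.tm.m k) x S).var .init
        (TM2.stepAux (M.tm.m k) x S).stk ⟨l, a, c, e, s⟩) := by
  rw [← stepAux_trStmt]
  simp [cfg, prog, hk, stk_clk, update_clk, Ctl.init]
  rfl

/-! #### The query phase -/

theorem step_scan_nil (ht : t.reset = t) :
    TM2.step prog (cfg (d := d) (phase .scan) x t S ⟨[], a, c, e, s⟩) =
      some (cfg (phase .rewind) x { t with mode := .hdr } S ⟨[], a, c, e, s⟩) := by
  rw [← ht]
  simp [cfg, prog, leave, stk_inp, update_inp, Ctl.reset]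

theorem step_scan_bar (ht : t.reset = t) :
    TM2.step prog (cfg (d := d) (phase .scan) x t S ⟨.bar :: l, a, c, e, s⟩) =
      some (cfg (phase .scan) x { t with mode := t.mode.next } S ⟨l, .bar :: a, c, e, s⟩) := by
  rw [← ht]
  simp [cfg, prog, leave, stk_inp, stk_aux, update_inp, update_aux, Ctl.reset]

theorem step_scan_comma (ht : t.reset = t) :
    TM2.step prog (cfg (d := d) (phase .scan) x t S ⟨.comma :: l, a, c, e, s⟩) =
      some (cfg (phase .restore) x t.record S ⟨l, .comma :: a, c, e, s⟩) := by
  rw [← ht]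
  simp [cfg, prog, leave, stk_inp, stk_aux, update_inp, update_aux, Ctl.reset, Ctl.record]
  exact ⟨rfl, rfl⟩

theorem step_scan_header (ht : t.reset = t) (hm : t.mode = .hdr) :
    TM2.step prog (cfg (d := d) (phase .scan) x t S ⟨.one :: l, a, c, e, s⟩) =
      some (cfg (phase .scan) x t S ⟨l, .one :: a, c, e, s⟩) := by
  rw [← ht]
  simp [cfg, prog, leave, stk_inp, stk_aux, update_inp, update_aux, Ctl.reset, hm]

theorem step_scan_bit (ht : t.reset = t) (hm : t.mode ≠ .hdr) (hz : z = .zero ∨ z = .one)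
    (w : List Letter) :
    TM2.step prog (cfg (d := d) (phase .scan) x t
        (Function.update S M.queryStack (w.map M.queryAlphabet.symm)) ⟨z :: l, a, c, e, s⟩) =
      some (cfg (phase .scan) x { t with ok := t.ok && t.mode.cmp z w.head? }
        (Function.update S M.queryStack (w.tail.map M.queryAlphabet.symm))
        ⟨l, z :: a, c, e, w.head?.toList ++ s⟩) := by
  rw [← ht]
  have h1 : z ≠ .bar := by rcases hz with rfl | rfl <;> simp
  have h2 : z ≠ .comma := by rcases hz with rfl | rfl <;> simp
  cases w <;>
  simp [cfg, prog, leave, stk_inp, stk_aux, update_inp, update_aux, Ctl.reset, hm, h1, h2, stk_inl,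
    update_inl, stk_saved, update_saved]

theorem step_restore_cons (ht : t.reset = t) (w : List Letter) :
    TM2.step prog (cfg (d := d) (phase .restore) x t
        (Function.update S M.queryStack (w.map M.queryAlphabet.symm)) ⟨l, a, c, e, z :: s⟩) =
      some (cfg (phase .restore) x t
        (Function.update S M.queryStack ((z :: w).map M.queryAlphabet.symm)) ⟨l, a, c, e, s⟩) := by
  rw [← ht]
  simp [cfg, prog, leave, stk_inl, update_inl, stk_saved, update_saved, Ctl.reset]

theorem step_restore_nil (ht : t.reset = t) :
    TM2.step prog (cfg (d := d) (phase .restore) x t S ⟨l, a, c, e, []⟩) =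
      some (cfg (phase .scan) x t S ⟨l, a, c, e, []⟩) := by
  rw [← ht]
  simp [cfg, prog, leave, stk_saved, update_saved, Ctl.reset]

theorem step_rewind_cons (ht : t.reset = t) :
    TM2.step prog (cfg (d := d) (phase .rewind) x t S ⟨l, z :: a, c, e, s⟩) =
      some (cfg (phase .rewind) x t S ⟨z :: l, a, c, e, s⟩) := by
  rw [← ht]
  simp [cfg, prog, leave, stk_inp, stk_aux, update_inp, update_aux, Ctl.reset]

theorem step_rewind_nil (ht : t.reset = t) :
    TM2.step prog (cfg (d := d) (phase .rewind) x t S ⟨l, [], c, e, s⟩) =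
      some (cfg (phase .erase) x t S ⟨l, [], c, e, s⟩) := by
  rw [← ht]
  simp [cfg, prog, leave, stk_aux, update_aux, Ctl.reset]

theorem step_erase_cons (ht : t.reset = t) (w : List Letter) :
    TM2.step prog (cfg (d := d) (phase .erase) x t
        (Function.update S M.queryStack ((z :: w).map M.queryAlphabet.symm)) ⟨l, a, c, e, s⟩) =
      some (cfg (phase .erase) x t
        (Function.update S M.queryStack (w.map M.queryAlphabet.symm)) ⟨l, a, c, e, s⟩) := by
  rw [← ht]
  simp [cfg, prog, leave, stk_inl, update_inl, Ctl.reset]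

/-- The answer to the query, or the rejection of the instance. -/
theorem step_erase_nil (ht : t.reset = t) :
    TM2.step prog (cfg (d := d) (phase .erase) x t
        (Function.update S M.queryStack []) ⟨l, a, c, e, s⟩) =
      some (cfg (if t.inY then .inl M.yes else if t.inX then .inl M.no else phase .clean) x
        { Ctl.init with ans := t.inY || t.inX }
        (Function.update S M.queryStack []) ⟨l, a, c, e, s⟩) := by
  rw [← ht]
  obtain ⟨cu, wc, m, ok, _ | _, _ | _, b, an⟩ := t <;>
  simp [cfg, prog, stk_inl, update_inl, Ctl.reset, Ctl.init, contLabel]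

end Step

/-! ### The construction of the clock -/

section Clock

variable (x : M.tm.σ) (S : ∀ k, List (M.tm.Γ k)) (l a c e s : List Letter) (j : Fin (d + 1))

/-- The unary representation of a number. -/
abbrev unary (n : ℕ) : List Letter := List.replicate n .one

theorem reach_mulScan (n : ℕ) :
    Reach (l.length + 1) (cfg (mulPhase j .scan) x .init S ⟨l, a, c, unary n, s⟩)
      (cfg (mulPhase j .back) x .init S ⟨[], l.reverse ++ a, c, unary (n + l.length), s⟩) := by
  induction l generalizing a n with
  | nil => exact .single (step_mulScan_nil ..)
  | cons z l ih =>
    have := ih (z :: a) (n + 1)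
    rw [add_assoc, add_comm 1] at this
    simpa using Reach.head (step_mulScan_cons ..) this

theorem reach_mulBack :
    Reach (a.length + 1) (cfg (mulPhase j .back) x .init S ⟨l, a, c, e, s⟩)
      (cfg (mulPhase j .outer) x .init S ⟨a.reverse ++ l, [], c, e, s⟩) := by
  induction a generalizing l with
  | nil => exact .single (step_mulBack_nil ..)
  | cons z a ih => simpa using Reach.head (step_mulBack_cons ..) (ih (z :: l))

theorem reach_mulMove (n m : ℕ) :
    Reach (n + 1) (cfg (mulPhase j .move) x .init S ⟨l, a, unary m, unary n, s⟩)
      (cfg (nextRound j) x .init S ⟨l, a, unary (m + n), [], s⟩) := by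
  induction n generalizing m with
  | zero => exact .single (step_mulMove_nil ..)
  | succ n ih =>
    have := ih (m + 1)
    rw [add_assoc, add_comm 1] at this
    exact Reach.head (step_mulMove_cons ..) this

/-- Each clock letter costs one pop, `ℓ + 1` steps to scan the input and `ℓ + 1` to put it back. -/
theorem reach_mulOuter (n m : ℕ) :
    Reach (m * (2 * l.length + 3) + 1)
      (cfg (mulPhase j .outer) x .init S ⟨l, [], unary m, unary n, s⟩)
      (cfg (mulPhase j .move) x .init S ⟨l, [], [], unary (n + m * l.length), s⟩) := by
  induction m generalizing n with
  | zero => simpa using Reach.single (step_mulOuter_nil ..)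
  | succ m ih =>
    have h1 := reach_mulScan x S l [] (unary m) s j n
    have h2 := reach_mulBack x S [] (l.reverse ++ []) (unary m) (unary (n + l.length)) s j
    have h3 := ih (n + l.length)
    simp only [List.append_nil, List.reverse_reverse, List.length_reverse] at h1 h2
    have h := Reach.head (step_mulOuter_cons x S l [] (unary m) (unary n) s .one j)
      ((h1.trans h2).trans h3)
    have e1 : n + l.length + m * l.length = n + (m + 1) * l.length := by ring
    rw [e1] at h
    exact h.mono (by ring_nf; omega)

theorem reach_round (m : ℕ) :
    Reach (m * (3 * l.length + 3) + 2)
      (cfg (mulPhase j .outer) x .init S ⟨l, [], unary m, [], s⟩)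
      (cfg (nextRound j) x .init S ⟨l, [], unary (m * l.length), [], s⟩) := by
  have h1 := reach_mulOuter x S l s j 0 m
  have h2 := reach_mulMove x S l [] s j (0 + m * l.length) 0
  simp only [zero_add] at h1 h2
  exact (h1.trans h2).mono (by ring_nf; omega)

/-- Since the input is nonempty the clock never decreases from round to round, so the final bound
`N` also bounds the cost of every earlier round. -/
theorem reach_rounds (hl : 1 ≤ l.length) (N i : ℕ) (hi : i < d + 1) (m : ℕ)
    (hN : m * l.length ^ (i + 1) ≤ N) :
    Reach ((i + 1) * (N * (3 * l.length + 3) + 2))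
      (cfg (mulPhase ⟨i, hi⟩ .outer) x .init S ⟨l, [], unary m, [], s⟩)
      (cfg (contLabel (some M.tm.main)) x .init S
        ⟨l, [], unary (m * l.length ^ (i + 1)), [], s⟩) := by
  have hm : m ≤ N := (Nat.le_mul_of_pos_right m (by positivity)).trans hN
  have h1 := (reach_round x S l s ⟨i, hi⟩ m).mono
    (Nat.add_le_add_right (Nat.mul_le_mul_right (3 * l.length + 3) hm) 2)
  induction i generalizing m with
  | zero =>
    rw [zero_add, pow_one, one_mul]
    exact h1
  | succ i ih =>
    have e1 : m * l.length * l.length ^ (i + 1) = m * l.length ^ (i + 1 + 1) := by ring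
    have hm' : m * l.length ≤ N :=
      (Nat.le_mul_of_pos_right (m * l.length) (by positivity)).trans (e1.le.trans hN)
    have h2 := ih (by omega) (m * l.length) (e1.le.trans hN) hm'
      ((reach_round x S l s ⟨i, by omega⟩ (m * l.length)).mono
        (Nat.add_le_add_right (Nat.mul_le_mul_right (3 * l.length + 3) hm') 2))
    rw [e1] at h2
    exact (h1.trans h2).mono (by ring_nf; omega)

theorem reach_header (n : ℕ) (w : List (M.tm.Γ M.tm.k₀)) :
    Reach (n + 1)
      (cfg (d := d) (phase .header) x .init (Function.update S M.tm.k₀ w)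
        ⟨unary n ++ .bar :: l, a, c, e, s⟩)
      (cfg (mulPhase (Fin.last d) .back) x .init
        (Function.update S M.tm.k₀ ((unary n).map M.inputAlphabet.symm ++ w))
        ⟨.bar :: l, unary n ++ a, c, e, s⟩) := by
  induction n generalizing w a with
  | zero => exact .single (step_header_bar ..)
  | succ n ih =>
    have h := Reach.head (step_header_one x (Function.update S M.tm.k₀ w)
      (unary n ++ .bar :: l) a c e s) (by
        rw [Function.update_self, Function.update_idem]
        exact ih (.one :: a) (M.inputAlphabet.symm .one :: w))
    have e1 : unary n ++ .one :: a = unary (n + 1) ++ a := by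
      rw [unary, unary, List.replicate_succ', List.append_assoc]; rfl
    have e2 : (unary n).map M.inputAlphabet.symm ++ M.inputAlphabet.symm .one :: w =
        (unary (n + 1)).map M.inputAlphabet.symm ++ w := by
      simp [unary, List.replicate_succ']
    rw [e1, e2] at h
    exact h

/-- The preparation of the simulation. -/
theorem reach_prepare (n : ℕ) (r : List Letter) (N : ℕ)
    (hN : (unary n ++ .bar :: r).length ^ (d + 1) = N) :
    Reach (2 * n + 3 + (d + 1) * (N * (3 * (unary n ++ .bar :: r).length + 3) + 2))
      (cfg (d := d) (phase .start) x .init (fun _ => []) ⟨unary n ++ .bar :: r, [], [], [], []⟩)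
      (cfg (contLabel (some M.tm.main)) x .init
        (Function.update (fun _ => []) M.tm.k₀
          ((unary n ++ [Letter.bar]).map M.inputAlphabet.symm))
        ⟨unary n ++ .bar :: r, [], unary N, [], []⟩) := by
  have h1 := Reach.single (step_start (d := d) x (fun _ => []) (unary n ++ .bar :: r) [] [] [] [])
  have h2 := reach_header (d := d) x (fun _ => []) r [] [.one] [] [] n [M.inputAlphabet.symm .bar]
  have h3 := reach_mulBack x (Function.update (fun _ => []) M.tm.k₀
    ((unary n).map M.inputAlphabet.symm ++ [M.inputAlphabet.symm .bar]))
    (.bar :: r) (unary n ++ []) [.one] [] [] (Fin.last d)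
  have h4 := reach_rounds x (Function.update (fun _ => []) M.tm.k₀
    ((unary n).map M.inputAlphabet.symm ++ [M.inputAlphabet.symm .bar]))
    (unary n ++ .bar :: r) [] (by simp; omega) N d (Nat.lt_succ_self d) 1 (by rw [one_mul, hN])
  have e1 : (unary n ++ []).reverse ++ .bar :: r = unary n ++ .bar :: r := by simp
  rw [e1] at h3
  rw [one_mul, hN] at h4
  have h := ((h1.trans h2).trans h3).trans h4
  rw [List.map_append]
  refine h.mono ?_
  simp
  omega

end Clock
end CrowdMachine

/-! ### The evaluation of a query -/

namespace Mode

theorem matchBits_iff (m : Mode) (bs w : List Letter) :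
    m.matchBits bs w = true ↔ ∀ i (h : i < bs.length), m.cmp bs[i] w[i]? = true := by
  induction bs generalizing w with
  | nil => simp [matchBits]
  | cons z bs ih =>
    rw [matchBits, Bool.and_eq_true, ih]
    constructor
    · rintro ⟨h1, h2⟩ (_ | i) h
      · simpa [List.head?_eq_getElem?] using h1
      · simpa [List.getElem?_tail] using h2 i (by simpa using h)
    · intro h
      rw [List.head?_eq_getElem?]
      refine ⟨h 0 (Nat.succ_pos _), fun i hi => ?_⟩
      rw [List.getElem?_tail]
      exact h (i + 1) (Nat.succ_lt_succ hi)

theorem encodeVec_getElem {n : ℕ} (v : Fin n → Bool) (i : ℕ) (h : i < (encodeVec v).length) :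
    (encodeVec v)[i] = .one ↔ v ⟨i, by simpa [encodeVec_length] using h⟩ = true := by
  simp [encodeVec]

open Classical in
theorem matchBits_xs {n : ℕ} (v : Fin n → Bool) (w : List Letter) :
    Mode.xs.matchBits (encodeVec v) w = decide (v ≤ wordVec n w) := by
  rw [Bool.eq_iff_iff, matchBits_iff, decide_eq_true_iff]
  simp only [cmp, decide_eq_true_iff, encodeVec_getElem]
  constructor
  · intro h i
    simpa [wordVec, Bool.le_iff_imp] using h i (by simp [encodeVec_length])
  · intro h i hi
    simpa [wordVec, Bool.le_iff_imp] using h ⟨i, by simpa [encodeVec_length] using hi⟩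

open Classical in
theorem matchBits_ys {n : ℕ} (v : Fin n → Bool) (w : List Letter) :
    Mode.ys.matchBits (encodeVec v) w = decide (wordVec n w ≤ v) := by
  rw [Bool.eq_iff_iff, matchBits_iff, decide_eq_true_iff]
  simp only [cmp, decide_eq_true_iff, encodeVec_getElem]
  constructor
  · intro h i
    simpa [wordVec, Bool.le_iff_imp] using h i (by simp [encodeVec_length])
  · intro h i hi
    simpa [wordVec, Bool.le_iff_imp] using h ⟨i, by simpa [encodeVec_length] using hi⟩

end Mode

theorem mem_encodeVec {n : ℕ} {v : Fin n → Bool} {z : Letter} (h : z ∈ encodeVec v) :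
    z = .zero ∨ z = .one := by
  simp only [encodeVec, List.mem_map] at h
  obtain ⟨_ | _, -, rfl⟩ := h <;> simp

theorem encodeVecs_cons_append {n : ℕ} (v : Fin n → Bool) (X : List (Fin n → Bool))
    (l : List Letter) :
    encodeVecs (v :: X) ++ l = encodeVec v ++ .comma :: (encodeVecs X ++ l) := by
  simp [encodeVecs]

theorem encodeVecs_cons_reverse_append {n : ℕ} (v : Fin n → Bool) (X : List (Fin n → Bool))
    (a : List Letter) :
    (encodeVecs (v :: X)).reverse ++ a =
      (encodeVecs X).reverse ++ ((encodeVec v ++ [Letter.comma]).reverse ++ a) := by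
  simp [encodeVecs]

theorem encodeVecs_cons_length {n : ℕ} (v : Fin n → Bool) (X : List (Fin n → Bool)) :
    (encodeVecs (v :: X)).length = n + 1 + (encodeVecs X).length := by
  simp only [encodeVecs_length, List.length_cons]
  ring

/-- The internal state during the evaluation of a query. -/
def Ctl.query (m : Mode) (ok inX inY : Bool) : Ctl := ⟨none, none, m, ok, inX, inY, false, true⟩

theorem Ctl.reset_query (m : Mode) (ok inX inY : Bool) :
    (Ctl.query m ok inX inY).reset = Ctl.query m ok inX inY := rfl

namespace CrowdMachine

variable {M : CrowdMachine} {d : ℕ}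

section Query

variable (x : M.tm.σ) (S : ∀ k, List (M.tm.Γ k)) (l a c e s w : List Letter)

/-- The stacks of the simulated machine, with a given word on the query stack. -/
abbrev withQuery (S : ∀ k, List (M.tm.Γ k)) (w : List Letter) : ∀ k, List (M.tm.Γ k) :=
  Function.update S M.queryStack (w.map M.queryAlphabet.symm)

/-- The compared prefix of the query moves in reverse onto `saved`; `take` and `drop` also cover
queries shorter than the vector. -/
theorem reach_scan_bits (bs : List Letter) (hbs : ∀ z ∈ bs, z = .zero ∨ z = .one) {m : Mode}
    (hm : m ≠ .hdr) (ok bx bY : Bool) :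
    Reach bs.length
      (cfg (d := d) (phase .scan) x (.query m ok bx bY) (withQuery S w) ⟨bs ++ l, a, c, e, s⟩)
      (cfg (phase .scan) x (.query m (ok && m.matchBits bs w) bx bY) (withQuery S (w.drop bs.length))
        ⟨l, bs.reverse ++ a, c, e, (w.take bs.length).reverse ++ s⟩) := by
  induction bs generalizing a s w ok with
  | nil => simpa [Mode.matchBits] using Reach.refl 0 _
  | cons z bs ih =>
    have h1 := step_scan_bit (d := d) x S (bs ++ l) a c e s z (.query m ok bx bY)
      (Ctl.reset_query ..) hm (hbs z (by simp)) w
    have h2 := ih (z :: a) (w.head?.toList ++ s) w.tail (fun y hy => hbs y (by simp [hy]))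
      (ok && m.cmp z w.head?)
    rw [Bool.and_assoc, List.drop_tail] at h2
    have h := Reach.head h1 h2
    have e1 : (w.tail.take bs.length).reverse ++ (w.head?.toList ++ s) =
        (w.take (bs.length + 1)).reverse ++ s := by
      cases w <;> simp
    have e2 : bs.reverse ++ z :: a = (z :: bs).reverse ++ a := by simp
    rw [e1, e2] at h
    exact h

theorem reach_restore (t : Ctl) (ht : t.reset = t) :
    Reach (s.length + 1)
      (cfg (d := d) (phase .restore) x t (withQuery S w) ⟨l, a, c, e, s⟩)
      (cfg (phase .scan) x t (withQuery S (s.reverse ++ w)) ⟨l, a, c, e, []⟩) := by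
  induction s generalizing w with
  | nil => exact .single (step_restore_nil _ _ _ _ _ _ _ ht)
  | cons z s ih => simpa using Reach.head (step_restore_cons _ _ _ _ _ _ _ _ _ ht _) (ih (z :: w))

/-- `n` bits, the comma, and at most `n + 1` steps to restore the query for the next vector. -/
theorem reach_scan_vec {n : ℕ} (v : Fin n → Bool) {m : Mode} (hm : m ≠ .hdr) (bx bY : Bool) :
    Reach (2 * (n + 1))
      (cfg (d := d) (phase .scan) x (.query m true bx bY) (withQuery S w)
        ⟨encodeVec v ++ .comma :: l, a, c, e, []⟩)
      (cfg (phase .scan) x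
        (.query m true (bx || (m.matchBits (encodeVec v) w && decide (m = .xs)))
          (bY || (m.matchBits (encodeVec v) w && decide (m = .ys))))
        (withQuery S w) ⟨l, (encodeVec v ++ [Letter.comma]).reverse ++ a, c, e, []⟩) := by
  have h1 := reach_scan_bits (d := d) x S (.comma :: l) a c e [] w (encodeVec v)
    (fun _ => mem_encodeVec) hm true bx bY
  have h2 := step_scan_comma (d := d) x (withQuery S (w.drop (encodeVec v).length)) l
    ((encodeVec v).reverse ++ a) c e ((w.take (encodeVec v).length).reverse ++ [])
    (.query m (true && m.matchBits (encodeVec v) w) bx bY) (Ctl.reset_query ..)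
  have h3 := reach_restore (d := d) x S l (.comma :: ((encodeVec v).reverse ++ a)) c e
    ((w.take (encodeVec v).length).reverse ++ []) (w.drop (encodeVec v).length)
    (Ctl.query m (true && m.matchBits (encodeVec v) w) bx bY).record rfl
  have h := h1.trans (Reach.head h2 h3)
  have e1 : ((w.take (encodeVec v).length).reverse ++ []).reverse ++ w.drop (encodeVec v).length =
      w := by simp
  have e2 : (encodeVec v ++ [Letter.comma]).reverse ++ a =
      .comma :: ((encodeVec v).reverse ++ a) := by simp
  rw [e1] at h
  rw [e2]
  refine h.mono ?_
  simp only [List.append_nil, List.length_reverse, List.length_take, encodeVec_length]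
  omega

open Classical in
theorem reach_scan_xs {n : ℕ} (X : List (Fin n → Bool)) (bx bY : Bool) :
    Reach (2 * (encodeVecs X).length)
      (cfg (d := d) (phase .scan) x (.query .xs true bx bY) (withQuery S w)
        ⟨encodeVecs X ++ l, a, c, e, []⟩)
      (cfg (phase .scan) x
        (.query .xs true (bx || X.any fun v => decide (v ≤ wordVec n w)) bY)
        (withQuery S w) ⟨l, (encodeVecs X).reverse ++ a, c, e, []⟩) := by
  induction X generalizing a bx with
  | nil => simpa [encodeVecs] using Reach.refl 0 _
  | cons v X ih =>
    have h1 := reach_scan_vec (d := d) x S (encodeVecs X ++ l) a c e w v (m := .xs) (by simp) bx bY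
    rw [Mode.matchBits_xs] at h1
    simp only [reduceCtorEq, decide_true, decide_false, Bool.and_true, Bool.and_false,
      Bool.or_false] at h1
    have h := h1.trans (ih ((encodeVec v ++ [Letter.comma]).reverse ++ a) (bx || decide (v ≤ wordVec n w)))
    rw [encodeVecs_cons_append, encodeVecs_cons_reverse_append, encodeVecs_cons_length,
      List.any_cons, ← Bool.or_assoc]
    refine h.mono ?_
    omega

open Classical in
theorem reach_scan_ys {n : ℕ} (Y : List (Fin n → Bool)) (bx bY : Bool) :
    Reach (2 * (encodeVecs Y).length)
      (cfg (d := d) (phase .scan) x (.query .ys true bx bY) (withQuery S w)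
        ⟨encodeVecs Y ++ l, a, c, e, []⟩)
      (cfg (phase .scan) x
        (.query .ys true bx (bY || Y.any fun v => decide (wordVec n w ≤ v)))
        (withQuery S w) ⟨l, (encodeVecs Y).reverse ++ a, c, e, []⟩) := by
  induction Y generalizing a bY with
  | nil => simpa [encodeVecs] using Reach.refl 0 _
  | cons v Y ih =>
    have h1 := reach_scan_vec (d := d) x S (encodeVecs Y ++ l) a c e w v (m := .ys) (by simp) bx bY
    rw [Mode.matchBits_ys] at h1
    simp only [reduceCtorEq, decide_true, decide_false, Bool.and_true, Bool.and_false,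
      Bool.or_false] at h1
    have h := h1.trans (ih ((encodeVec v ++ [Letter.comma]).reverse ++ a) (bY || decide (wordVec n w ≤ v)))
    rw [encodeVecs_cons_append, encodeVecs_cons_reverse_append, encodeVecs_cons_length,
      List.any_cons, ← Bool.or_assoc]
    refine h.mono ?_
    omega

theorem reach_scan_header (n : ℕ) (bx bY : Bool) :
    Reach n
      (cfg (d := d) (phase .scan) x (.query .hdr true bx bY) S ⟨unary n ++ l, a, c, e, s⟩)
      (cfg (phase .scan) x (.query .hdr true bx bY) S ⟨l, unary n ++ a, c, e, s⟩) := by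
  induction n generalizing a with
  | zero => exact Reach.refl _ _
  | succ n ih =>
    have h := Reach.head (step_scan_header (d := d) x S (unary n ++ l) a c e s
      (.query .hdr true bx bY) (Ctl.reset_query ..) rfl) (ih (.one :: a))
    have e1 : unary n ++ .one :: a = unary (n + 1) ++ a := by
      rw [unary, unary, List.replicate_succ', List.append_assoc]; rfl
    rw [e1] at h
    exact h

theorem reach_rewind (t : Ctl) (ht : t.reset = t) :
    Reach (a.length + 1) (cfg (d := d) (phase .rewind) x t S ⟨l, a, c, e, s⟩)
      (cfg (phase .erase) x t S ⟨a.reverse ++ l, [], c, e, s⟩) := by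
  induction a generalizing l with
  | nil => exact .single (step_rewind_nil _ _ _ _ _ _ _ ht)
  | cons z a ih => simpa using Reach.head (step_rewind_cons _ _ _ _ _ _ _ _ _ ht) (ih (z :: l))

theorem reach_erase (t : Ctl) (ht : t.reset = t) :
    Reach (w.length + 1)
      (cfg (d := d) (phase .erase) x t (withQuery S w) ⟨l, a, c, e, s⟩)
      (cfg (if t.inY then .inl M.yes else if t.inX then .inl M.no else phase .clean) x
        { Ctl.init with ans := t.inY || t.inX }
        (Function.update S M.queryStack []) ⟨l, a, c, e, s⟩) := by
  induction w with
  | nil => exact .single (step_erase_nil _ _ _ _ _ _ _ _ ht)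
  | cons z w ih => exact Reach.head (step_erase_cons _ _ _ _ _ _ _ _ _ ht _) ih

open Classical in
-- Scanning costs at most twice the input length because of the restorations, rewinding costs it
-- once more, and erasing costs the length of the query.
theorem reach_query (J : EQInstance) :
    Reach (3 * J.encode.length + w.length + 3)
      (cfg (d := d) (phase .scan) x .init (withQuery S w) ⟨J.encode, [], c, e, []⟩)
      (cfg (if wordVec J.n w ∈ downSet J.Y then .inl M.yes
          else if wordVec J.n w ∈ upSet J.X then .inl M.no else phase .clean) x
        { Ctl.init with ans := decide (wordVec J.n w ∈ upSet J.X ∪ downSet J.Y) }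
        (Function.update S M.queryStack []) ⟨J.encode, [], c, e, []⟩) := by
  set rY := encodeVecs J.Y with hrY
  set rX := encodeVecs J.X with hrX
  have hJ : J.encode = unary J.n ++ Letter.bar :: (rX ++ Letter.bar :: (rY ++ [])) := by
    simp [EQInstance.encode, rX, rY]
  have h1 := reach_scan_header (d := d) x (withQuery S w) (Letter.bar :: (rX ++ Letter.bar :: (rY ++ [])))
    [] c e [] J.n false false
  have h2 := Reach.single (step_scan_bar (d := d) x (withQuery S w) (rX ++ Letter.bar :: (rY ++ []))
    (unary J.n ++ []) c e [] (.query .hdr true false false) rfl)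
  have h3 := reach_scan_xs (d := d) x S (Letter.bar :: (rY ++ [])) (Letter.bar :: (unary J.n ++ [])) c e w J.X
    false false
  have h4 := Reach.single (step_scan_bar (d := d) x (withQuery S w) (rY ++ [])
    (rX.reverse ++ Letter.bar :: (unary J.n ++ [])) c e []
    (.query .xs true (false || J.X.any fun v => decide (v ≤ wordVec J.n w)) false) rfl)
  have h5 := reach_scan_ys (d := d) x S [] (Letter.bar :: (rX.reverse ++ Letter.bar :: (unary J.n ++ [])))
    c e w J.Y (false || J.X.any fun v => decide (v ≤ wordVec J.n w)) false
  rw [← hrX] at h3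
  rw [← hrY] at h5
  have h6 := Reach.single (step_scan_nil (d := d) x (withQuery S w)
    (rY.reverse ++ Letter.bar :: (rX.reverse ++ Letter.bar :: (unary J.n ++ []))) c e []
    (.query .ys true (false || J.X.any fun v => decide (v ≤ wordVec J.n w))
      (false || J.Y.any fun v => decide (wordVec J.n w ≤ v))) rfl)
  have h7 := reach_rewind (d := d) x (withQuery S w) []
    (rY.reverse ++ Letter.bar :: (rX.reverse ++ Letter.bar :: (unary J.n ++ []))) c e []
    (.query .hdr true (false || J.X.any fun v => decide (v ≤ wordVec J.n w))
      (false || J.Y.any fun v => decide (wordVec J.n w ≤ v))) rfl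
  have e7 : (rY.reverse ++ Letter.bar :: (rX.reverse ++ Letter.bar :: (unary J.n ++ []))).reverse ++ [] =
      J.encode := by
    rw [hJ]; simp [unary]
  rw [e7] at h7
  have h8 := reach_erase (d := d) x S J.encode [] c e [] w
    (.query .hdr true (false || J.X.any fun v => decide (v ≤ wordVec J.n w))
      (false || J.Y.any fun v => decide (wordVec J.n w ≤ v))) rfl
  have hX : (J.X.any fun v => decide (v ≤ wordVec J.n w)) =
      decide (wordVec J.n w ∈ upSet J.X) := by
    rw [Bool.eq_iff_iff]; simp only [List.any_eq_true, decide_eq_true_eq]; rfl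
  have hY : (J.Y.any fun v => decide (wordVec J.n w ≤ v)) =
      decide (wordVec J.n w ∈ downSet J.Y) := by
    rw [Bool.eq_iff_iff]; simp only [List.any_eq_true, decide_eq_true_eq]; rfl
  have h := (h1.trans <| h2.trans <| h3.trans <| h4.trans <| h5.trans <| h6.trans <|
    h7.trans h8).mono (u := 3 * J.encode.length + w.length + 3) (by
      rw [hJ]
      simp only [List.length_append, List.length_cons, List.length_reverse, List.length_nil,
        unary, List.length_replicate]
      omega)
  rw [← hJ] at h
  have e9 : decide (wordVec J.n w ∈ upSet J.X ∪ downSet J.Y) =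
      (decide (wordVec J.n w ∈ downSet J.Y) || decide (wordVec J.n w ∈ upSet J.X)) := by
    rw [Bool.eq_iff_iff]; simp [or_comm]
  rw [e9]
  simp only [Ctl.query, hX, hY, Bool.false_or, decide_eq_true_eq] at h
  exact h

end Query
end CrowdMachine

/-! ### Growth of the stacks -/

/-- The number of letters that a statement can push. -/
def pushCount {K : Type*} {Γ : K → Type*} {Λ σ : Type*} : TM2.Stmt Γ Λ σ → ℕ
  | .push _ _ q => pushCount q + 1
  | .peek _ _ q => pushCount q
  | .pop _ _ q => pushCount q
  | .load _ q => pushCount q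
  | .branch _ q₁ q₂ => pushCount q₁ + pushCount q₂
  | .goto _ => 0
  | .halt => 0

/-- Bounds the length of the queries and the final stack heights, on which the cost of erasing and
cleaning depends. -/
theorem length_stepAux_le {K : Type*} [DecidableEq K] {Γ : K → Type*} {Λ σ : Type*}
    (q : TM2.Stmt Γ Λ σ) (v : σ) (S : ∀ k, List (Γ k)) (k : K) :
    ((TM2.stepAux q v S).stk k).length ≤ (S k).length + pushCount q := by
  induction q generalizing v S with
  | push k' f q ih =>
    refine (ih v _).trans ?_
    by_cases h : k = k'
    · subst h; simp [pushCount]; omega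
    · simp [pushCount, h]
  | peek k' f q ih => exact ih _ _
  | pop k' f q ih =>
    refine (ih _ _).trans ?_
    by_cases h : k = k'
    · subst h; simp [pushCount]
    · simp [pushCount, h]
  | load f q ih => exact ih _ _
  | branch p q₁ q₂ ih₁ ih₂ =>
    have h1 := ih₁ v S
    have h2 := ih₂ v S
    simp only [TM2.stepAux, pushCount]
    cases p v <;> simp only [cond_true, cond_false] <;> omega
  | goto f => simp [pushCount]
  | halt => simp [pushCount]

namespace CrowdMachine

variable {M : CrowdMachine} {d : ℕ}

/-- A bound on the number of letters that a step pushes. -/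
def pushBound (M : CrowdMachine) : ℕ := ∑ l, pushCount (M.tm.m l)

theorem pushCount_le (l : M.tm.Λ) : pushCount (M.tm.m l) ≤ M.pushBound :=
  Finset.single_le_sum (f := fun l => pushCount (M.tm.m l)) (fun _ _ => Nat.zero_le _)
    (Finset.mem_univ l)

theorem haltsWithin_succ_iff {oracle good : List Letter → Prop} {c c' : M.Cfg} {t : ℕ}
    (hc : c.l ≠ none) (hs : M.step oracle c = some c') :
    M.HaltsWithin oracle good (t + 1) c ↔
      (c.l = some M.ask → good (M.queryWord c)) ∧ M.HaltsWithin oracle good t c' := by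
  constructor
  · rintro (⟨_, _, h⟩ | ⟨_, _, c'', hs', hg, h⟩)
    · exact absurd h hc
    · rw [hs] at hs'
      obtain rfl := Option.some.inj hs'
      exact ⟨hg, h⟩
  · rintro ⟨hg, h⟩
    exact .step _ _ _ hs hg h

theorem withQuery_queryWord (c : M.Cfg) : withQuery c.stk (M.queryWord c) = c.stk := by
  simp [queryWord]

/-! ### The simulation -/

open Classical in
-- The clock and the time index of `HaltsWithin` decrease together, so the verdict is exactly that
-- predicate. `h` bounds the present stack heights and `H` all later ones; a step costs at most one
-- clock pop and one query evaluation.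
theorem reach_simulation (J : EQInstance) (H r : ℕ) (c : M.Cfg) (h : ℕ)
    (hc : ∀ k, (c.stk k).length ≤ h) (hH : h + r * M.pushBound ≤ H) :
    ∃ (x : M.tm.σ) (S : ∀ k, List (M.tm.Γ k)) (r' : ℕ), r' ≤ r ∧ (∀ k, (S k).length ≤ H) ∧
      Reach (r * (3 * J.encode.length + H + 4) + 1)
        (cfg (d := d) (contLabel c.l) c.var .init c.stk ⟨J.encode, [], unary r, [], []⟩)
        (cfg (phase .clean) x
          { Ctl.init with ans := decide (M.HaltsWithin (fun w => wordVec J.n w ∈ downSet J.Y)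
            (fun w => wordVec J.n w ∈ upSet J.X ∪ downSet J.Y) r c) }
          S ⟨J.encode, [], unary r', [], []⟩) := by
  set oracle : List Letter → Prop := fun w => wordVec J.n w ∈ downSet J.Y with horacle
  set good : List Letter → Prop := fun w => wordVec J.n w ∈ upSet J.X ∪ downSet J.Y with hgood
  induction r generalizing c h with
  | zero =>
    rcases hl : c.l with _ | l
    · refine ⟨c.var, c.stk, 0, le_rfl, fun k => (hc k).trans (by omega), ?_⟩
      rw [decide_eq_true (HaltsWithin.halted _ _ hl)]
      exact Reach.refl _ _
    · refine ⟨c.var, c.stk, 0, le_rfl, fun k => (hc k).trans (by omega), ?_⟩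
      rw [decide_eq_false]
      · exact (Reach.single (step_sim_nil ..)).mono (by omega)
      · rintro ⟨_, _, h⟩
        rw [h] at hl
        cases hl
  | succ r ih =>
    rcases hl : c.l with _ | l
    · refine ⟨c.var, c.stk, r + 1, le_rfl, fun k => (hc k).trans (by omega), ?_⟩
      rw [decide_eq_true (HaltsWithin.halted _ _ hl)]
      exact Reach.refl _ _
    have hcl : c.l ≠ none := by simp [hl]
    have e1 : (r + 1) * M.pushBound = r * M.pushBound + M.pushBound := by ring
    by_cases hask : l = M.ask
    · subst hask
      have h1 := Reach.single (step_sim_ask (d := d) c.var c.stk J.encode [] (unary r) [] [] .one)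
      have h2 := reach_query (d := d) c.var c.stk (unary r) [] (M.queryWord c) J
      rw [withQuery_queryWord] at h2
      have hw : (M.queryWord c).length ≤ H := by
        simpa [queryWord] using (hc M.queryStack).trans (by omega)
      have hs : M.step oracle c = some
          { l := some (if oracle (M.queryWord c) then M.yes else M.no)
            var := c.var
            stk := Function.update c.stk M.queryStack [] } := by
        unfold queryWord
        by_cases ho : oracle ((c.stk M.queryStack).map M.queryAlphabet) <;>
          simp [CrowdMachine.step, hl, ho]
      have hlen : ∀ k, (Function.update c.stk M.queryStack [] k).length ≤ h := by
        intro k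
        by_cases hk : k = M.queryStack
        · subst hk; simp
        · simpa [hk] using hc k
      have hiff := haltsWithin_succ_iff (good := good) (t := r) hcl hs
      by_cases hg : good (M.queryWord c)
      · obtain ⟨x, S, r', hr', hS, h3⟩ := ih
          { l := some (if oracle (M.queryWord c) then M.yes else M.no)
            var := c.var
            stk := Function.update c.stk M.queryStack [] } h hlen (by omega)
        refine ⟨x, S, r', by omega, hS, ?_⟩
        have e2 : M.HaltsWithin oracle good (r + 1) c ↔ _ := hiff.trans (and_iff_right fun _ => hg)
        rw [decide_eq_decide.2 e2]
        -- A good query outside `F(Y)` lies in `T(X)`, so the jump is the one dictated by the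
        -- oracle.
        have e3 : (if wordVec J.n (M.queryWord c) ∈ downSet J.Y then .inl M.yes
            else if wordVec J.n (M.queryWord c) ∈ upSet J.X then .inl M.no
              else phase .clean : M.SimΛ d) =
            contLabel (some (if oracle (M.queryWord c) then M.yes else M.no)) := by
          by_cases hY : wordVec J.n (M.queryWord c) ∈ downSet J.Y
          · simp [hY, horacle, contLabel]
          · simp [hY, horacle, contLabel, show wordVec J.n (M.queryWord c) ∈ upSet J.X from
              hg.resolve_right hY]
        rw [e3, decide_eq_true hg] at h2
        exact ((h1.trans h2).trans h3).mono (by ring_nf; omega)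
      · refine ⟨c.var, Function.update c.stk M.queryStack [], r, by omega,
          fun k => (hlen k).trans (by omega), ?_⟩
        rw [decide_eq_false fun h => hg ((hiff.1 h).1 hl)]
        have hX : wordVec J.n (M.queryWord c) ∉ upSet J.X := fun h => hg (Or.inl h)
        have hY : wordVec J.n (M.queryWord c) ∉ downSet J.Y := fun h => hg (Or.inr h)
        rw [decide_eq_false hg, if_neg hX, if_neg hY] at h2
        exact (h1.trans h2).mono (by ring_nf; omega)
    · have h1 := Reach.single
        (step_sim (d := d) c.var c.stk J.encode [] (unary r) [] [] .one hask)
      have hs : M.step oracle c = some (TM2.stepAux (M.tm.m l) c.var c.stk) := by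
        obtain ⟨l', v, S⟩ := c
        obtain rfl : l' = some l := hl
        simp [CrowdMachine.step, hask]
      have hlen : ∀ k, ((TM2.stepAux (M.tm.m l) c.var c.stk).stk k).length ≤ h + M.pushBound :=
        fun k => (length_stepAux_le _ _ _ _).trans (Nat.add_le_add (hc k) (pushCount_le l))
      obtain ⟨x, S, r', hr', hS, h3⟩ := ih _ _ hlen (by omega)
      refine ⟨x, S, r', by omega, hS, ?_⟩
      have e2 := (haltsWithin_succ_iff (good := good) (t := r) hcl hs).trans
        (and_iff_right fun h => absurd (Option.some.inj (hl.symm.trans h)) hask)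
      rw [decide_eq_decide.2 e2]
      exact (h1.trans h3).mono (by ring_nf; omega)

/-! ### The final phase -/

open Classical in
theorem stepAux_popAll (q : M.SimStmt d) (ks : List M.SimK) (hks : ks.Nodup) (x : M.tm.σ) (t : Ctl)
    (T : ∀ k, List (M.SimΓ k)) :
    TM2.stepAux (popAll q ks) (x, t) T =
      TM2.stepAux q (x, { t with busy := t.busy || ks.any fun k => !(T k).isEmpty })
        (fun k => if k ∈ ks then (T k).tail else T k) := by
  induction ks generalizing t T with
  | nil => simp [popAll]
  | cons k ks ih =>
    obtain ⟨hk, hks⟩ := List.nodup_cons.1 hks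
    rw [popAll, TM2.stepAux, ih hks]
    congr 1
    · have e1 : (T k).head?.isSome = !(T k).isEmpty := by cases T k <;> rfl
      have e2 : (ks.any fun j => !(Function.update T k (T k).tail j).isEmpty) =
          ks.any fun j => !(T j).isEmpty := by
        rw [Bool.eq_iff_iff, List.any_eq_true, List.any_eq_true]
        refine exists_congr fun j => and_congr_right fun hj => ?_
        rw [Function.update_of_ne (ne_of_mem_of_not_mem hj hk)]
      simp only [e1, e2, List.any_cons, Bool.or_assoc]
    · funext j
      by_cases hj : j = k
      · subst hj; simp [hk]
      · simp [hj]

/-- Every pass shortens each nonempty stack by one, so after at most `N` passes a last one finds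
nothing and writes the answer. -/
theorem reach_clean (N : ℕ) (x : M.tm.σ) (t : Ctl) (ht : t.busy = false)
    (T : ∀ k, List (M.SimΓ k)) (hT : ∀ k, (T k).length ≤ N) :
    Reach (d := d) (N + 1) ⟨some (phase .clean), (x, t), T⟩
      ⟨none, (M.tm.initialState, .init), Function.update (fun _ => []) (.inr .out) [t.ans]⟩ := by
  classical
  have hstep := stepAux_popAll (d := d)
    (.branch (fun v => v.2.busy)
        (.load (onCtl fun t => { t with busy := false }) <| .goto fun _ => phase .clean)
        (.push (.inr .out) (fun v => v.2.ans) <|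
          .load (fun _ => (M.tm.initialState, Ctl.init)) .halt))
      Finset.univ.toList (Finset.nodup_toList _) x t T
  simp only [Finset.mem_toList, Finset.mem_univ, if_true, ht, Bool.false_or] at hstep
  by_cases hall : ∀ k, T k = []
  · have hany : ((Finset.univ : Finset M.SimK).toList.any fun k => !(T k).isEmpty) = false := by
      rw [List.any_eq_false]
      simp [hall]
    rw [hany] at hstep
    refine (Reach.single ?_).mono (by omega : 1 ≤ N + 1)
    rw [TM2.step]
    refine congrArg some (hstep.trans ?_)
    simp [hall]
  · have hany : ((Finset.univ : Finset M.SimK).toList.any fun k => !(T k).isEmpty) = true := by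
      push Not at hall
      obtain ⟨k, hk⟩ := hall
      exact List.any_eq_true.2 ⟨k, by simp, by simpa using hk⟩
    cases N with
    | zero => exact absurd (fun k => List.eq_nil_of_length_eq_zero (Nat.le_zero.1 (hT k))) hall
    | succ N =>
      have h := reach_clean N x { t with busy := false } rfl (fun k => (T k).tail) fun k => by
        have := hT k
        simp only [List.length_tail]
        omega
      refine Reach.head ?_ h
      rw [TM2.step]
      refine congrArg some (hstep.trans ?_)
      simp [hany]

/-! ### Assembly of the decision procedure -/

/-- The simulator. -/
noncomputable def simMachine (M : CrowdMachine) (d : ℕ) : FinTM2 where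
  K := M.SimK
  k₀ := .inr .inp
  k₁ := .inr .out
  Γ := M.SimΓ
  Λ := M.SimΛ d
  main := phase .start
  σ := M.Simσ
  initialState := (M.tm.initialState, .init)
  Γk₀Fin := inferInstanceAs (Fintype Letter)
  m := prog

theorem initList_eq (tm : FinTM2) (s : List (tm.Γ tm.k₀)) :
    initList tm s = ⟨some tm.main, tm.initialState, Function.update (fun _ => []) tm.k₀ s⟩ := by
  refine congrArg (TM2.Cfg.mk _ _) (funext fun k => ?_)
  by_cases h : k = tm.k₀
  · subst h; simp
  · simp [h]

theorem haltList_eq (tm : FinTM2) (s : List (tm.Γ tm.k₁)) :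
    haltList tm s = ⟨none, tm.initialState, Function.update (fun _ => []) tm.k₁ s⟩ := by
  refine congrArg (TM2.Cfg.mk _ _) (funext fun k => ?_)
  by_cases h : k = tm.k₁
  · subst h; simp
  · simp [h]

theorem stk_init (l : List Letter) :
    stk (M := M) (fun _ => []) ⟨l, [], [], [], []⟩ =
      Function.update (β := fun k => List (M.SimΓ k)) (fun _ => []) (.inr .inp) l := by
  funext k
  rcases k with k | k
  · simp [stk]
  · cases k <;> simp [stk]

open Classical in
-- The summands of the bound are the preparation, the simulation and the cleaning. `H` bounds the
-- simulated stacks and the input, `N` the unused clock.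
theorem reach_answer (M : CrowdMachine) (d : ℕ) (J : EQInstance) (ℓ N H : ℕ)
    (hℓ : J.encode.length = ℓ) (hN : ℓ ^ (d + 1) = N) (hH : ℓ + N * M.pushBound = H) :
    Reach (M := M) (d := d)
      (2 * ℓ + 3 + (d + 1) * (N * (3 * ℓ + 3) + 2) + (N * (3 * ℓ + H + 4) + 1) + (N + H + 1))
      (cfg (phase .start) M.tm.initialState .init (fun _ => []) ⟨J.encode, [], [], [], []⟩)
      ⟨none, (M.tm.initialState, .init), Function.update (fun _ => []) (.inr .out)
        [decide (M.HaltsWithin (fun w => wordVec J.n w ∈ downSet J.Y)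
            (fun w => wordVec J.n w ∈ upSet J.X ∪ downSet J.Y) N
            (initList M.tm ((List.replicate J.n Letter.one ++ [Letter.bar]).map
              M.inputAlphabet.symm)))]⟩ := by
  have hJ : J.encode = unary J.n ++ .bar :: (encodeVecs J.X ++ .bar :: encodeVecs J.Y) := by
    simp [EQInstance.encode]
  have hnℓ : J.n + 1 ≤ ℓ := by
    have := J.length_encode
    omega
  have h1 := reach_prepare (M := M) (d := d) M.tm.initialState J.n
    (encodeVecs J.X ++ .bar :: encodeVecs J.Y) N (by rw [← hJ, hℓ, hN])
  rw [← hJ, hℓ] at h1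
  obtain ⟨x, S, r', hr', hS, h2⟩ := reach_simulation (M := M) (d := d) J H N
    (initList M.tm ((List.replicate J.n Letter.one ++ [Letter.bar]).map M.inputAlphabet.symm)) ℓ
    (by
      intro k
      rw [initList_eq]
      by_cases hk : k = M.tm.k₀
      · subst hk; simpa using hnℓ
      · simp [hk])
    hH.le
  rw [hℓ] at h2
  have h3 := reach_clean (M := M) (d := d) (N + H) x
    { Ctl.init with ans := decide (M.HaltsWithin (fun w => wordVec J.n w ∈ downSet J.Y)
            (fun w => wordVec J.n w ∈ upSet J.X ∪ downSet J.Y) N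
            (initList M.tm ((List.replicate J.n Letter.one ++ [Letter.bar]).map
              M.inputAlphabet.symm))) } rfl (stk S ⟨J.encode, [], unary r', [], []⟩) (by
      rintro (k | k)
      · exact (hS k).trans (by omega)
      · cases k <;> simp [stk] <;> omega)
  have e1 : (initList M.tm ((List.replicate J.n Letter.one ++ [Letter.bar]).map
      M.inputAlphabet.symm)).stk = _ := congrArg TM2.Cfg.stk (initList_eq M.tm _)
  rw [e1] at h2
  have h4 := (h1.trans h2).trans h3
  exact h4.mono (by omega)

end CrowdMachine

/-- For `ℓ ≥ 2` the sum of the coefficients is itself below a fixed power of `ℓ`, so a pure power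
dominates `p` and the clock needs only repeated multiplication by `ℓ`. -/
theorem MvPolynomial_exists_eval_le_pow {σ : Type*} (p : MvPolynomial σ ℕ) :
    ∃ d : ℕ, ∀ ℓ, 2 ≤ ℓ → MvPolynomial.eval (fun _ => ℓ) p ≤ ℓ ^ (d + 1) := by
  refine ⟨∑ m ∈ p.support, p.coeff m + p.totalDegree, fun ℓ hℓ => ?_⟩
  rw [MvPolynomial.eval_eq]
  calc ∑ m ∈ p.support, p.coeff m * ∏ i ∈ m.support, ℓ ^ m i
      ≤ ∑ m ∈ p.support, p.coeff m * ℓ ^ p.totalDegree := by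
        refine Finset.sum_le_sum fun m hm => Nat.mul_le_mul_left _ ?_
        rw [Finset.prod_pow_eq_pow_sum]
        exact Nat.pow_le_pow_right (by omega) (MvPolynomial.le_totalDegree hm)
    _ = (∑ m ∈ p.support, p.coeff m) * ℓ ^ p.totalDegree := by rw [Finset.sum_mul]
    _ ≤ ℓ ^ (∑ m ∈ p.support, p.coeff m) * ℓ ^ p.totalDegree :=
        Nat.mul_le_mul_right _ (Nat.lt_pow_self (by omega)).le
    _ ≤ _ := by
        rw [← pow_add]
        exact Nat.pow_le_pow_right (by omega) (Nat.le_succ _)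

theorem mainTheorem7 (Θ : ℝ) (hΘ0 : 0 < Θ) (hΘ1 : Θ < 1) (h : MineFreqSolvableInPolyTime Θ) :
    EQSolvableInPolyTime := by
  classical
  obtain ⟨M, p, hM⟩ := h
  obtain ⟨d, hd⟩ := MvPolynomial_exists_eval_le_pow p
  let N : Polynomial ℕ := .X ^ (d + 1)
  let H : Polynomial ℕ := .X + N * .C M.pushBound
  refine ⟨{
    tm := M.simMachine d
    inputAlphabet := Equiv.refl Letter
    outputAlphabet := Equiv.refl Bool
    time := 2 * .X + 3 + (.C d + 1) * (N * (3 * .X + 3) + 2) + (N * (3 * .X + H + 4) + 1) +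
      (N + H + 1)
    outputsFun := fun J => Classical.choice ?_ }⟩
  have hreach := M.reach_answer d J J.encode.length _ _ rfl rfl rfl
  -- The two bars alone give length two.
  have hlen : 2 ≤ J.encode.length := by
    have := J.length_encode
    omega
  have hanswer : decide (M.HaltsWithin (fun w => wordVec J.n w ∈ downSet J.Y)
      (fun w => wordVec J.n w ∈ upSet J.X ∪ downSet J.Y) (J.encode.length ^ (d + 1))
      (initList M.tm ((List.replicate J.n Letter.one ++ [Letter.bar]).map M.inputAlphabet.symm))) =
      J.answer :=
    decide_eq_decide.2 (haltsWithin_iff hΘ0 hΘ1 hM J (hd _ hlen))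
  rw [hanswer] at hreach
  obtain ⟨s, hs, e⟩ := hreach
  refine ⟨⟨⟨s, ?_⟩, hs.trans (le_of_eq ?_)⟩⟩
  · rw [CrowdMachine.initList_eq, Option.map_some, CrowdMachine.haltList_eq]
    rw [CrowdMachine.cfg, CrowdMachine.stk_init] at e
    refine Eq.trans ?_ (e.trans ?_)
    · congr
      exact List.map_id _
    · rfl
  · simp [N, H]
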